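/- **Setting.** Let $V$ be a finite set and $\mathcal H=\bigotimes_{v\in V}\mathbb C^{d_v}$ with all $d_v>1$. On operators on $\mathcal H$ put $(A|B)=\mathrm{tr}(AB)/\dim\mathcal H$ (for Hermitian $A,B$), and let $\|\cdot\|$ be the operator (spectral) norm. Let $\mathbb P_v$ be the projection onto the operators acting non-trivially on the tensor factor at $v$: $\mathbb P_v\bigl(\bigotimes_u T_u\bigr)$ equals $\bigotimes_u T_u$ if $\mathrm{tr}\,T_v=0$ and equals $0$ if $T_v=1$. An operator $O$ is $X$-local ($X\subseteq V$) if $\mathbb P_vO=O$ for $v\in X$ and $\mathbb P_vO=0$ for $v\notin X$. Let $F$ be a finite set of factors; each $X\in F$ has an underlying node set contained in $V$, also written $X$ (different factors may have the same node set). Let $H_X$ ($X\in F$) be Hermitian $X$-local operators with $(H_X|H_Y)=\mathbb I(X=Y)$, and let $J_X$ ($X\in F$) be independent real random variables with $\mathbb E[J_X]=0$ and $\mathbb E[J_X^2]=\mathcal J_X^2<\infty$. Put $H=\sum_X J_XH_X$, $\mathcal L O=\mathrm i[H,O]$, $A(t)=\mathrm e^{\mathcal Lt}A$. For $i\neq j$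 in $V$ and a nonzero Hermitian $\{i\}$-local operator $A$ let $C_{ij}(t)^2=(A(t)|\mathbb P_j|A(t))/(A|A)$. **Causal tree pairs.** Consider sequences $\mathcal M=(i,X_1,\dots,X_k,j,X_{k+1},\dots,X_n)$ with $X_m\in F$ and $0\le k\le n$, where the node $j$ is inserted at one place. The causal forest of such a sequence is the graph built by reading it from left to right as follows. Start with the vertex $i$. When an entry (a factor or $j$) is read for the first time, add it as a vertex and join it to the earliest previous entry with which it has a node in common, if there is one (the entries $i$ and $j$ have the node sets $\{i\}$ and $\{j\}$); repeated entries change nothing. Put $\mathcal M_{\mathrm R}=\mathcal M$ and $\mathcal M_{\mathrm L}=(i,X_n,\dots,X_{k+1},j,X_k,\dots,X_1)$. Let $\mathbb M^2_{ji}$ be the set of those sequences in which every factor that occurs occurs at least twice, some factor contains $j$, and the causal forests of both $\mathcal M_{\mathrm L}$ and $\mathcal M_{\mathrm R}$ are connected; the latter two then form the causal tree pair $\mathbb T(\mathcal M)=(T_{\mathrm L},T_{\mathrm R})$. A causal tree pair is irreducible if it contains (componentwise, as subgraphs) no other causal tree pair; $\mathcal S^2_{ji}$ is the set of irreducible causal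 tree pairs. For $(Q_{\mathrm L},Q_{\mathrm R})\in\mathcal S^2_{ji}$ let $\Psi(Q_{\mathrm L},Q_{\mathrm R})$ be the set of $\psi\in\mathbb M^2_{ji}$ with $\mathbb T(\psi)=(Q_{\mathrm L},Q_{\mathrm R})$ whose number of entries from $F$ is twice the number of factors of $Q_{\mathrm L}$, and let $\ell_{\mathrm R}(\psi)=k$ and $\ell_{\mathrm L}(\psi)=n-k$ be the numbers of factors between $i$ and $j$ in $\psi_{\mathrm R}$ and $\psi_{\mathrm L}$. **Theorem.** For every $t\in\mathbb R$, $C_{ij}(t)^2$ is integrable and $$\mathbb E\left[C_{ij}(t)^2\right]\le\sum_{(Q_{\mathrm L},Q_{\mathrm R})\in\mathcal S^2_{ji}}\ \sum_{\psi\in\Psi(Q_{\mathrm L},Q_{\mathrm R})}\frac{1}{\ell_{\mathrm L}(\psi)!\,\ell_{\mathrm R}(\psi)!}\prod_{X\in Q_{\mathrm L}\cup Q_{\mathrm R}}\left(2\,\mathcal J_X\,\|H_X\|\,t\right)^2 .$$ In particular, if $\|H_X\|=1$ for all $X\in F$, then $$\mathbb E\left[C_{ij}(t)^2\right]\le\sum_{(Q_{\mathrm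 L},Q_{\mathrm R})\in\mathcal S^2_{ji}}\ \sum_{\psi\in\Psi(Q_{\mathrm L},Q_{\mathrm R})}\frac{1}{\ell_{\mathrm L}(\psi)!\,\ell_{\mathrm R}(\psi)!}\prod_{X\in Q_{\mathrm L}\cup Q_{\mathrm R}}\left(2\mathcal J_X t\right)^2 .$$ -/

import Mathlib

open MeasureTheory
open scoped Matrix.Norms.L2Operator Nat

namespace OperatorGrowth

section Operators

variable {V : Type*} [Fintype V] [DecidableEq V] {d : V → ℕ}

/-- Labels of the product basis of the Hilbert space `⨂ v, ℂ ^ (d v)`. -/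
abbrev Config (d : V → ℕ) : Type _ := ∀ v, Fin (d v)

/-- Operators on `⨂ v, ℂ ^ (d v)`, as matrices in the product basis. The norm on them is the
operator (spectral) norm. -/
abbrev Op (d : V → ℕ) : Type _ := Matrix (Config d) (Config d) ℂ

/-- The inner product `(A|B) = tr (A B) / dim`; the trace is real for Hermitian `A`, `B`. -/
noncomputable def hsInner (A B : Op d) : ℝ :=
  (A * B).trace.re / (Fintype.card (Config d) : ℝ)

/-- The part of an operator that acts trivially on the tensor factor at `j`: the normalized partial
trace over that factor, tensored with the identity there. -/
noncomputable def trivialPart (j : V) : Op d →ₗ[ℂ] Op d where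
  toFun O := Matrix.of fun x y =>
    if x j = y j then
      (d j : ℂ)⁻¹ * ∑ s : Fin (d j), O (Function.update x j s) (Function.update y j s)
    else 0
  map_add' A B := by
    ext x y
    by_cases h : x j = y j <;> simp [h, Finset.sum_add_distrib, mul_add]
  map_smul' c A := by
    ext x y
    by_cases h : x j = y j <;> simp [h, Finset.mul_sum, mul_left_comm]

/-- The projection `ℙ_j` onto the operators that act non-trivially on the tensor factor at `j`. -/
noncomputable def proj (j : V) : Op d →ₗ[ℂ] Op d :=
  LinearMap.id - trivialPart j

/-- The product operator `⨂ v, T v`. -/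
def productOp (T : ∀ v, Matrix (Fin (d v)) (Fin (d v)) ℂ) : Op d :=
  Matrix.of fun x y => ∏ v, T v (x v) (y v)

theorem trivialPart_productOp (j : V) (T : ∀ v, Matrix (Fin (d v)) (Fin (d v)) ℂ) :
    trivialPart j (productOp T) =
      ((d j : ℂ)⁻¹ * (T j).trace) • productOp (Function.update T j 1) := by
  ext x y
  have key : ∀ (S : ∀ v, Matrix (Fin (d v)) (Fin (d v)) ℂ) (a b : Config d),
      ∏ v, S v (a v) (b v) = S j (a j) (b j) * ∏ v ∈ Finset.univ.erase j, S v (a v) (b v) :=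
    fun S a b => (Finset.mul_prod_erase _ _ (Finset.mem_univ j)).symm
  have rest : ∀ s : Fin (d j),
      ∏ v ∈ Finset.univ.erase j, T v (Function.update x j s v) (Function.update y j s v) =
        ∏ v ∈ Finset.univ.erase j, T v (x v) (y v) := fun s =>
    Finset.prod_congr rfl fun v hv => by
      rw [Function.update_of_ne (Finset.ne_of_mem_erase hv),
        Function.update_of_ne (Finset.ne_of_mem_erase hv)]
  have rest' : ∏ v ∈ Finset.univ.erase j, Function.update T j 1 v (x v) (y v) =
      ∏ v ∈ Finset.univ.erase j, T v (x v) (y v) :=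
    Finset.prod_congr rfl fun v hv => by
      rw [Function.update_of_ne (Finset.ne_of_mem_erase hv)]
  simp only [trivialPart, productOp, LinearMap.coe_mk, AddHom.coe_mk, Matrix.of_apply,
    Matrix.smul_apply, smul_eq_mul]
  rw [key (Function.update T j 1), rest']
  simp_rw [key T, rest]
  by_cases h : x j = y j
  · simp [h, Matrix.trace, Matrix.diag, Finset.sum_mul, mul_assoc]
  · simp [h]

/-- `ℙ_j` annihilates a product operator whose factor at `j` is the identity. -/
theorem proj_productOp_of_eq_one (hd : ∀ v, 1 < d v) (j : V)
    (T : ∀ v, Matrix (Fin (d v)) (Fin (d v)) ℂ) (h : T j = 1) : proj j (productOp T) = 0 := by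
  have h0 : (d j : ℂ) ≠ 0 := by
    have := hd j
    exact_mod_cast (by omega : d j ≠ 0)
  have h1 : Function.update T j 1 = T := by rw [← h, Function.update_eq_self]
  simp [proj, trivialPart_productOp, h1, h, h0]

/-- `ℙ_j` fixes a product operator whose factor at `j` is traceless. -/
theorem proj_productOp_of_trace_eq_zero (j : V)
    (T : ∀ v, Matrix (Fin (d v)) (Fin (d v)) ℂ) (h : (T j).trace = 0) :
    proj j (productOp T) = productOp T := by
  simp [proj, trivialPart_productOp, h]

/-- `O` is `X`-local: it acts non-trivially on the tensor factors in `X`, and only on those. -/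
def IsLocal (X : Finset V) (O : Op d) : Prop :=
  ∀ v, proj v O = if v ∈ X then O else 0

/-- The Liouvillian `O ↦ i [H, O]`. -/
noncomputable def liouvillian (H : Op d) : Op d →ₗ[ℂ] Op d :=
  Complex.I • (LinearMap.mulLeft ℂ H - LinearMap.mulRight ℂ H)

/-- The time evolved operator `A(t) = e^{ℒ t} A`. -/
noncomputable def evolve (H : Op d) (t : ℝ) (A : Op d) : Op d :=
  NormedSpace.exp ((t : ℂ) • LinearMap.toContinuousLinearMap (liouvillian H)) A

/-- `C_{ij}(t) = √((A(t)|ℙ_j|A(t)) / (A|A))`, for an operator `A` local at `i`. -/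
noncomputable def growth (H : Op d) (A : Op d) (j : V) (t : ℝ) : ℝ :=
  Real.sqrt (hsInner (evolve H t A) (proj j (evolve H t A)) / hsInner A A)

/-- The Hamiltonian `H(J) = ∑ X, J_X H_X`. -/
noncomputable def hamiltonian {F : Type*} [Fintype F] (H : F → Op d) (J : F → ℝ) : Op d :=
  ∑ X, (J X : ℂ) • H X

end Operators

section CausalTrees

/-- The possible vertices of a causal forest: the root node `i`, the factors, the target node `j`. -/
inductive CausalVertex (F : Type*) : Type _
  | root : CausalVertex F
  | factor (X : F) : CausalVertex F
  | target : CausalVertex F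
  deriving DecidableEq

instance {F : Type*} [Finite F] : Finite (CausalVertex F) :=
  Finite.of_surjective (fun x : Option (Option F) => match x with
    | none => CausalVertex.root
    | some none => CausalVertex.target
    | some (some X) => CausalVertex.factor X) fun v => by
    cases v with
    | root => exact ⟨none, rfl⟩
    | target => exact ⟨some none, rfl⟩
    | factor X => exact ⟨some (some X), rfl⟩

/-- Graphs on a subset of the root, the factors and the target, ordered by inclusion. -/
abbrev CausalGraph (F : Type*) : Type _ := (⊤ : SimpleGraph (CausalVertex F)).Subgraph

/-- A sequence `(i, X₁, …, X_k, j, X_{k+1}, …, X_n)` of factors, with `j` marking the place of the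
projector: `right = [X₁, …, X_k]` and `left = [X_{k+1}, …, X_n]`. -/
@[ext]
structure TwoSided (F : Type*) : Type _ where
  right : List F
  left : List F

variable {V F : Type*} [DecidableEq V]

/-- The nodes touched by a vertex; `supp X` is the set of nodes of the factor `X`. -/
def nodes (supp : F → Finset V) (i j : V) : CausalVertex F → Finset V
  | .root => {i}
  | .factor X => supp X
  | .target => {j}

/-- The word `X₁ … X_k j X_{k+1} … X_n`. -/
def TwoSided.readRight (M : TwoSided F) : List (CausalVertex F) :=
  M.right.map .factor ++ .target :: M.left.map .factor

/-- The word `X_n … X_{k+1} j X_k … X₁`. -/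
def TwoSided.readLeft (M : TwoSided F) : List (CausalVertex F) :=
  M.left.reverse.map .factor ++ .target :: M.right.reverse.map .factor

/-- The list of all factors of the sequence, in order. -/
def TwoSided.factors (M : TwoSided F) : List F := M.right ++ M.left

variable [DecidableEq F]

/-- One step of the construction of causal forests. Here `seen` lists what was read so far, the root
first. Nothing changes if `a` was read before; otherwise `a` becomes a new vertex, joined to the
earliest entry of `seen` with which it has a node in common (hence to the root if `a` touches `i`),
and isolated if there is no such entry. -/
def attach (supp : F → Finset V) (i j : V) (seen : List (CausalVertex F)) (T : CausalGraph F)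
    (a : CausalVertex F) : CausalGraph F :=
  if a ∈ seen then T
  else
    match seen.find? (fun b => decide (nodes supp i j b ∩ nodes supp i j a).Nonempty) with
    | some b => T ⊔ (⊤ : CausalGraph F).induce {b, a}
    | none => T ⊔ SimpleGraph.singletonSubgraph _ a

/-- Reading on: `seen` was read and produced the forest `T`; the word in the last argument is
still to be read. -/
def grow (supp : F → Finset V) (i j : V) :
    List (CausalVertex F) → CausalGraph F → List (CausalVertex F) → CausalGraph F
  | _, T, [] => T
  | seen, T, a :: w => grow supp i j (seen ++ [a]) (attach supp i j seen T a) w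

/-- The causal forest `T(i, w)` of a word `w`. It is a causal tree if it is connected. -/
def causalForest (supp : F → Finset V) (i j : V) (w : List (CausalVertex F)) : CausalGraph F :=
  grow supp i j [.root] (SimpleGraph.singletonSubgraph _ .root) w

/-- The pair `(T_L, T_R)` of causal forests of a sequence. -/
def treePair (supp : F → Finset V) (i j : V) (M : TwoSided F) : CausalGraph F × CausalGraph F :=
  (causalForest supp i j M.readLeft, causalForest supp i j M.readRight)

/-- The sequences in which every factor that occurs occurs at least twice, some factor contains
`j`, and which are creeping (the causal forest is connected) when read from either side. -/
def creepingSequences (supp : F → Finset V) (i j : V) : Set (TwoSided F) :=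
  {M | (∀ X ∈ M.factors, 2 ≤ M.factors.count X) ∧ (∃ X ∈ M.factors, j ∈ supp X) ∧
    (treePair supp i j M).1.Connected ∧ (treePair supp i j M).2.Connected}

/-- The set of all causal tree pairs. -/
def causalTreePairs (supp : F → Finset V) (i j : V) : Set (CausalGraph F × CausalGraph F) :=
  treePair supp i j '' creepingSequences supp i j

/-- The irreducible causal tree pairs: those that contain no smaller causal tree pair. -/
def irreducibleTreePairs (supp : F → Finset V) (i j : V) : Set (CausalGraph F × CausalGraph F) :=
  {Q | Minimal (· ∈ causalTreePairs supp i j) Q}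

open scoped Classical in
/-- The factors that are vertices of `T`. -/
noncomputable def factorSet [Fintype F] (T : CausalGraph F) : Finset F :=
  Finset.univ.filter fun X => CausalVertex.factor X ∈ T.verts

/-- The orderings `ψ` of a causal tree pair: the sequences with that causal tree pair whose length
is twice the number of its factors. -/
def orderings [Fintype F] (supp : F → Finset V) (i j : V) (Q : CausalGraph F × CausalGraph F) :
    Set (TwoSided F) :=
  {ψ ∈ creepingSequences supp i j |
    treePair supp i j ψ = Q ∧ ψ.factors.length = 2 * (factorSet Q.1).card}

theorem finite_irreducibleTreePairs [Fintype F] (supp : F → Finset V) (i j : V) :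
    (irreducibleTreePairs supp i j).Finite :=
  Set.toFinite _

theorem finite_orderings [Fintype F] (supp : F → Finset V) (i j : V)
    (Q : CausalGraph F × CausalGraph F) : (orderings supp i j Q).Finite := by
  have hfin := (List.finite_length_le F (2 * (factorSet Q.1).card)).prod
    (List.finite_length_le F (2 * (factorSet Q.1).card))
  refine Set.Finite.of_injOn (f := fun ψ : TwoSided F => (ψ.right, ψ.left)) ?_ ?_ hfin
  · intro ψ hψ
    have h := hψ.2.2
    simp only [TwoSided.factors, List.length_append] at h
    simp only [Set.mem_prod, Set.mem_ofPred_eq]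
    omega
  · intro a _ b _ hab
    simp only [Prod.mk.injEq] at hab
    exact TwoSided.ext hab.1 hab.2

/-- The sum, over the irreducible causal tree pairs `(Q_L, Q_R)` and their orderings `ψ`, of
`1 / (ℓ_L(ψ)! ℓ_R(ψ)!)` times the product of `(2 g_X t)²` over the factors `X` of `Q_L` and `Q_R`. -/
noncomputable def treePairSum [Fintype F] (supp : F → Finset V) (i j : V) (g : F → ℝ) (t : ℝ) : ℝ :=
  ∑ Q ∈ (finite_irreducibleTreePairs supp i j).toFinset,
    ∑ ψ ∈ (finite_orderings supp i j Q).toFinset,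
      1 / ((ψ.left.length ! : ℝ) * (ψ.right.length ! : ℝ)) *
        ∏ X ∈ factorSet Q.1 ∪ factorSet Q.2, (2 * g X * t) ^ 2

end CausalTrees

end OperatorGrowth

/-!
Write `L_X` for the Liouvillian of `H_X`. Expanding `A(t)` in words of Liouvillians turns `Re tr
(A(t) (ℙ_j A(t)))` into a sum over two-sided words `(u, v)`, with the target `j` in the middle and
the factors of the two copies of `A(t)` on its two sides. Liouvillians are skew, so they can be
moved from one copy of `A` to the other. Hence a term vanishes unless the word, read from either
end, *creeps*: each entry has a node in common with an earlier entry or with the root `i`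
(`creeps_of_projForm_ne_zero`).

Absolute values of this series are too large, and the sum has to be reorganized before it is
estimated. The *core* of a creeping word is the smallest set of vertices that contains `j` and is
closed under taking parents in the two causal forests of the word. Marking the first and the last
occurrence of each factor in the core leaves a *reduced* word, in which every factor occurs at
most twice. Conversely a word is recovered from its reduced word by filling the gaps between the
marked letters, and the letters that may stand in a gap depend only on the reduced word and on the
gap: core factors marked on both sides of it, and factors outside the core that do not become
parents of vertices of the core. So every creeping word arises from exactly one reduced word, in
exactly one way (`exists_isReduced`), and the series is a finite sum over reduced words
(`bilin_evolved_eq_sum`).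

In the contribution of one reduced word, the letters of each gap resum to an evolution with a
restricted, but still skew, generator. It preserves the Hilbert–Schmidt norm, so that only the
norms of the marked letters and the volumes of the simplices of their times remain. This is the
Dyson bound `norm_dyson_le`, the source of the two factorials.

It remains to average. If a factor is marked only once, it may stand in no gap, and its coupling
enters the contribution as a mere factor with mean zero. If every factor is marked twice, each
coupling contributes its variance. These words are orderings of irreducible causal tree pairs
(`IsReduced.mem_orderings`): the causal forests of a smaller causal tree pair would still contain,
with each vertex, its parents, hence the core, which is everything.
-/

/-! ### Two-sided words and their cores -/

namespace OperatorGrowth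

section Words

variable {F : Type*}

/-- The first entry of `l` that touches `a`, where `R b a` means that `b` and `a` touch. -/
def firstTouch (R : CausalVertex F → CausalVertex F → Bool) (l : List (CausalVertex F))
    (a : CausalVertex F) : Option (CausalVertex F) :=
  l.find? fun b => R b a

/-- Every entry of the word `w` is preceded, at its first occurrence, by the root or by an entry
that touches it. -/
def Creeps (R : CausalVertex F → CausalVertex F → Bool) (w : List (CausalVertex F)) : Prop :=
  ∀ a ∈ w, ∃ b, firstTouch R (.root :: w) a = some b ∧ b ≠ a

/-- The word with the target in the middle; `u` and `v` list the factors on its two sides, both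
from the target outwards. -/
def outwardWord (u v : List F) : List (CausalVertex F) :=
  u.reverse.map .factor ++ .target :: v.map .factor

/-- The smallest set of vertices that contains the target and, with each vertex, its parents in the
two causal forests of the word. -/
inductive Core (R : CausalVertex F → CausalVertex F → Bool) (u v : List F) :
    CausalVertex F → Prop
  | target : Core R u v .target
  | right {a b : CausalVertex F} (ha : Core R u v a)
      (h : firstTouch R (.root :: outwardWord u v) a = some b) : Core R u v b
  | left {a b : CausalVertex F} (ha : Core R u v a)
      (h : firstTouch R (.root :: outwardWord v u) a = some b) : Core R u v b

/-- A factor `y` outside `S` may stand between the parts `p` and `q` of a word without becoming a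
parent of a vertex in `S` or of the target: whatever it touches there is touched, on both sides, by
the root or by an entry in `S` (the target counts as an entry on the side of `p`). -/
def Harmless (R : CausalVertex F → CausalVertex F → Bool) (S : Finset F) (p q : List F)
    (y : F) : Prop :=
  ∀ a, (a = .target ∨ ∃ x ∈ S, a = .factor x) → R (.factor y) a →
    (R .root a ∨ R .target a ∨ ∃ x ∈ S, x ∈ p ∧ R (.factor x) a) ∧
      (R .root a ∨ ∃ x ∈ S, x ∈ q ∧ R (.factor x) a)

/-- The letters allowed in the gap between the marked letters `C` and the marked letters `ψ`: those
of `S` that are marked on both sides, so that an occurrence in the gap is neither the first nor the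
last, and the harmless ones outside `S`. -/
def GapAllowed (R : CausalVertex F → CausalVertex F → Bool) (S : Finset F) (C ψ : List F)
    (y : F) : Prop :=
  (y ∈ S → y ∈ C ∧ y ∈ ψ) ∧ (y ∉ S → Harmless R S C ψ y)

open scoped Classical in
/-- The number of ways to obtain `v` from the list `ψ` of marked letters by filling the gaps with
allowed letters; `C` lists the letters that were marked before. -/
noncomputable def fillings (R : CausalVertex F → CausalVertex F → Bool) (S : Finset F) :
    List F → List F → List F → ℕ
  | _, [], [] => 1
  | _, _ :: _, [] => 0
  | C, [], y :: v => if GapAllowed R S C [] y then fillings R S C [] v else 0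
  | C, x :: ψ, y :: v => (if GapAllowed R S C (x :: ψ) y then fillings R S C (x :: ψ) v else 0) +
      if x = y then fillings R S (x :: C) ψ v else 0

variable {R : CausalVertex F → CausalVertex F → Bool} {S : Finset F}

theorem Harmless.congr {p q p' q' : List F} {y : F} (hp : ∀ x ∈ S, x ∈ p ↔ x ∈ p')
    (hq : ∀ x ∈ S, x ∈ q ↔ x ∈ q') : Harmless R S p q y ↔ Harmless R S p' q' y := by
  have h1 : ∀ a, (∃ x ∈ S, x ∈ p ∧ R (.factor x) a) ↔ ∃ x ∈ S, x ∈ p' ∧ R (.factor x) a := fun a =>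
    exists_congr fun x => and_congr_right fun hx => by rw [hp x hx]
  have h2 : ∀ a, (∃ x ∈ S, x ∈ q ∧ R (.factor x) a) ↔ ∃ x ∈ S, x ∈ q' ∧ R (.factor x) a := fun a =>
    exists_congr fun x => and_congr_right fun hx => by rw [hq x hx]
  simp only [Harmless, h1, h2]

/-- Filling gaps does not change which letters of `S` occur. -/
theorem mem_iff_of_fillings_ne_zero {C ψ v : List F} (h : fillings R S C ψ v ≠ 0) {x : F}
    (hx : x ∈ S) : x ∈ v ↔ x ∈ ψ := by
  classical
  induction v generalizing C ψ with
  | nil => cases ψ <;> simp_all [fillings]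
  | cons y v ih =>
    cases ψ with
    | nil =>
      simp only [fillings, ne_eq, ite_eq_right_iff, Classical.not_imp] at h
      have h' := ih h.2
      have : x ≠ y := by
        rintro rfl
        exact absurd (h.1.1 hx).2 (by simp)
      rw [List.mem_cons, h']
      simp [this]
    | cons z ψ =>
      simp only [fillings] at h
      by_cases h0 : (if GapAllowed R S C (z :: ψ) y then fillings R S C (z :: ψ) v else 0) = 0
      · rw [h0, zero_add] at h
        simp only [ne_eq, ite_eq_right_iff, Classical.not_imp] at h
        rw [List.mem_cons, List.mem_cons, ih h.2, h.1]
      · simp only [ite_eq_right_iff, Classical.not_imp] at h0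
        rw [List.mem_cons, ih h0.2]
        exact ⟨by rintro (rfl | h) <;> [exact (h0.1.1 hx).2; assumption], Or.inr⟩

variable [DecidableEq F]

/-- The list of those letters of `v` that lie in `S` and stand at the first or the last occurrence
of the letter in `p` followed by `v`. -/
def keep (S : Finset F) : List F → List F → List F
  | _, [] => []
  | p, y :: v => if y ∈ S ∧ (y ∉ p ∨ y ∉ v) then y :: keep S (y :: p) v else keep S (y :: p) v

/-- Every letter of `v` outside `S` is harmless, where `p` is what precedes `v`. -/
def AllHarmless (R : CausalVertex F → CausalVertex F → Bool) (S : Finset F) :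
    List F → List F → Prop
  | _, [] => True
  | p, y :: v => (y ∉ S → Harmless R S p v y) ∧ AllHarmless R S (y :: p) v

theorem mem_keep {p v : List F} {x : F} : x ∈ keep S p v ↔ x ∈ S ∧ x ∈ v := by
  induction v generalizing p with
  | nil => simp [keep]
  | cons y v ih =>
    rw [keep]
    split_ifs with h
    · rw [List.mem_cons, ih, List.mem_cons]
      constructor
      · rintro (rfl | h') <;> tauto
      · tauto
    · rw [ih, List.mem_cons]
      constructor
      · tauto
      · rintro ⟨hx, rfl | hv⟩ <;> tauto

theorem count_keep_le (p v : List F) (x : F) :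
    (keep S p v).count x ≤ if x ∈ p then 1 else 2 := by
  induction v generalizing p with
  | nil => simp [keep]
  | cons y v ih =>
    rw [keep]
    have h := ih (y :: p)
    by_cases hxy : y = x
    · subst hxy
      simp only [List.mem_cons, true_or, if_true] at h
      split_ifs with h1 h2
      · have : (keep S (y :: p) v).count y = 0 := by
          rw [List.count_eq_zero, mem_keep]
          tauto
        simp [this]
      · simp only [List.count_cons_self]
        omega
      · exact h
      · omega
    · simp only [List.mem_cons, Ne.symm hxy, false_or] at h
      split_ifs at h ⊢ <;> simp [hxy, h]

/-- The marked letters and the gaps around them can be recovered from a word: the marked letters are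
the first and the last occurrences of the letters in `S`. -/
theorem fillings_eq_ite (p C ψ v : List F) (h1 : ∀ x ∈ S, x ∈ p ↔ x ∈ C) (h2 : ∀ x ∈ ψ, x ∈ S)
    (h3 : ∀ x, (C ++ ψ).count x ≤ 2) [Decidable (ψ = keep S p v ∧ AllHarmless R S p v)] :
    fillings R S C ψ v = if ψ = keep S p v ∧ AllHarmless R S p v then 1 else 0 := by
  classical
  induction v generalizing p C ψ with
  | nil => cases ψ <;> simp [fillings, keep, AllHarmless]
  | cons y v ih =>
    by_cases hy : y ∈ S
    · have hg : ∀ ψ, GapAllowed R S C ψ y ↔ y ∈ C ∧ y ∈ ψ := fun ψ => by simp [GapAllowed, hy]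
      simp only [AllHarmless, hy, not_true_eq_false, false_imp_iff, true_and]
      -- Filling on without marking `y` is possible only if `y` was marked before.
      have key : (if GapAllowed R S C ψ y then fillings R S C ψ v else 0) =
          if y ∈ C ∧ y ∈ ψ ∧ ψ = keep S (y :: p) v ∧ AllHarmless R S (y :: p) v then 1 else 0 := by
        rw [hg]
        by_cases hC : y ∈ C
        · have := ih (y :: p) C ψ (fun x hx => by
            rw [List.mem_cons, h1 x hx]
            exact ⟨by rintro (rfl | h) <;> assumption, Or.inr⟩) h2 h3
          rw [this]
          by_cases hψ : y ∈ ψ <;> simp [hC, hψ]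
        · simp [hC]
      cases ψ with
      | nil =>
        simp only [fillings]
        rw [key, keep]
        simp only [List.not_mem_nil, false_and, and_false, if_false]
        rw [if_neg]
        rintro ⟨h, -⟩
        split_ifs at h with h'
        have := (mem_keep (S := S) (p := y :: p) (v := v) (x := y))
        rw [← h] at this
        simp only [List.not_mem_nil, false_iff] at this
        tauto
      | cons x ψ =>
        simp only [fillings]
        rw [key]
        by_cases hxy : x = y
        · subst hxy
          have h3' := h3 x
          simp only [List.count_append, List.count_cons_self] at h3'
          have ih' := ih (x :: p) (x :: C) ψ (fun z hz => by
            rw [List.mem_cons, List.mem_cons, h1 z hz]) (fun z hz => h2 z (by simp [hz]))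
            (fun z => by
              have := h3 z
              simp only [List.count_append, List.count_cons] at this ⊢
              omega)
          rw [if_pos rfl, ih', keep]
          by_cases hC : x ∈ C
          · have hp := (h1 x hy).2 hC
            have hc := List.count_pos_iff.2 hC
            have hψ : x ∉ ψ := fun h => by
              have := List.count_pos_iff.2 h
              omega
            by_cases hv : x ∈ v
            · have hk : x ∈ keep S (x :: p) v := mem_keep.2 ⟨hy, hv⟩
              have hne : ψ ≠ keep S (x :: p) v := fun h => hψ (h ▸ hk)
              simp [hC, hp, hv, hne]
            · have hk : x ∉ keep S (x :: p) v := fun h => hv (mem_keep.1 h).2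
              have hne : x :: ψ ≠ keep S (x :: p) v := fun h => hk (by rw [← h]; simp)
              simp [hC, hp, hv, hne, hy]
          · have hp : x ∉ p := fun h => hC ((h1 x hy).1 h)
            simp [hC, hp, hy]
        · rw [if_neg hxy, keep, add_zero]
          by_cases hC : y ∈ C
          · have hp := (h1 y hy).2 hC
            by_cases hv : y ∈ v
            · have hk : y ∈ keep S (y :: p) v := mem_keep.2 ⟨hy, hv⟩
              simp only [hC, hp, hv, hy, not_true_eq_false, or_false, and_false, if_false, true_and]
              refine if_congr ⟨fun h => h.2, fun h => ⟨by rw [h.1]; exact hk, h⟩⟩ rfl rfl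
            · have hk : y ∉ keep S (y :: p) v := fun h => hv (mem_keep.1 h).2
              have hne : ¬ (y ∈ x :: ψ ∧ x :: ψ = keep S (y :: p) v) := fun h => hk (h.2 ▸ h.1)
              simp only [hp, hv, hy, not_true_eq_false, not_false_eq_true, or_true, and_true,
                if_true, List.cons.injEq, hxy, false_and, if_false]
              rw [if_neg]
              tauto
          · have hp : y ∉ p := fun h => hC ((h1 y hy).1 h)
            simp [hC, hp, hy, hxy]
    · have hg : ∀ ψ, GapAllowed R S C ψ y ↔ Harmless R S C ψ y := fun ψ => by simp [GapAllowed, hy]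
      have hf : fillings R S C ψ (y :: v) =
          if Harmless R S C ψ y then fillings R S C ψ v else 0 := by
        cases ψ with
        | nil => simp only [fillings, hg]
        | cons x ψ =>
          have : x ≠ y := fun h => hy (h ▸ h2 x (by simp))
          simp only [fillings, hg, this, if_false, add_zero]
      rw [hf, ih (y :: p) C ψ (fun x hx => by
        rw [List.mem_cons, h1 x hx]
        exact ⟨by rintro (rfl | h) <;> [exact absurd hx hy; assumption], Or.inr⟩) h2 h3]
      have hk : keep S p (y :: v) = keep S (y :: p) v := by simp [keep, hy]
      simp only [hk, AllHarmless, hy, not_false_eq_true, true_imp_iff]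
      by_cases hψ : ψ = keep S (y :: p) v
      · have hh : Harmless R S C ψ y ↔ Harmless R S p v y :=
          Harmless.congr (fun x hx => (h1 x hx).symm) fun x hx => by
            rw [hψ, mem_keep]
            tauto
        rw [hh]
        by_cases h' : Harmless R S p v y <;> simp [h', hψ]
      · simp [hψ]

end Words

end OperatorGrowth

/-! ### Thinning words and reduced words -/

namespace OperatorGrowth

section Thinning

variable {α : Type*}

/-- `Thins S p W w`: the list `w` arises from `W` by deleting some entries, where an entry in `S`
may be deleted only if it occurred before, in `W` or in the list `p` of what precedes `W`. -/
inductive Thins (S : α → Prop) : List α → List α → List α → Prop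
  | nil (p : List α) : Thins S p [] []
  | keep {x : α} {p W w : List α} (h : Thins S (x :: p) W w) : Thins S p (x :: W) (x :: w)
  | drop {x : α} {p W w : List α} (hx : S x → x ∈ p) (h : Thins S (x :: p) W w) :
      Thins S p (x :: W) w

variable {S : α → Prop} {p q W w W' w' : List α}

theorem Thins.mono (h : Thins S p W w) (hpq : p ⊆ q) : Thins S q W w := by
  induction h generalizing q with
  | nil => exact .nil _
  | keep _ ih => exact .keep (ih (List.cons_subset_cons _ hpq))
  | drop hx _ ih => exact .drop (fun h => hpq (hx h)) (ih (List.cons_subset_cons _ hpq))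

theorem Thins.append (h : Thins S p W w) (h' : Thins S (W ++ p) W' w') :
    Thins S p (W ++ W') (w ++ w') := by
  induction h with
  | nil => exact h'
  | keep _ ih => exact .keep (ih (h'.mono fun x hx => by simp at hx ⊢; tauto))
  | drop hx _ ih => exact .drop hx (ih (h'.mono fun x hx => by simp at hx ⊢; tauto))

theorem Thins.find?_eq (h : Thins S p W w) {P : α → Bool} (hp : ∀ c ∈ p, S c → P c = false) {b : α}
    (hb : W.find? P = some b) (hS : S b) : w.find? P = some b := by
  induction h with
  | nil => simp at hb
  | @keep x p W w h ih =>
    cases hx : P x with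
    | true => simp_all
    | false =>
      rw [List.find?_cons_of_neg (by simp [hx])] at hb ⊢
      exact ih (by simpa [hx] using hp) hb
  | @drop x p W w hxp h ih =>
    cases hx : P x with
    | true =>
      rw [List.find?_cons_of_pos hx, Option.some_inj] at hb
      subst hb
      rw [hp _ (hxp hS) hS] at hx
      exact absurd hx (by simp)
    | false =>
      rw [List.find?_cons_of_neg (by simp [hx])] at hb
      exact ih (by simpa [hx] using hp) hb

end Thinning

section Partition

variable {F : Type*} [DecidableEq F] {R : CausalVertex F → CausalVertex F → Bool} {S : Finset F}

/-- The vertices over a set of factors: the root, the target and the factors in the set. -/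
def Over (S : Finset F) (a : CausalVertex F) : Prop :=
  a = .root ∨ a = .target ∨ ∃ x ∈ S, a = .factor x

theorem thins_keep {p v : List F} {q : List (CausalVertex F)} (hq : p.map .factor ⊆ q) :
    Thins (Over S) q (v.map .factor) ((keep S p v).map .factor) := by
  induction v generalizing p q with
  | nil => exact .nil _
  | cons y v ih =>
    have hi := ih (p := y :: p) (q := .factor y :: q) (by
      rw [List.map_cons]; exact List.cons_subset_cons _ hq)
    rw [keep]
    split_ifs with h
    · exact .keep hi
    · refine .drop (fun hy => hq ?_) hi
      obtain hy | hy | ⟨x, hx, hxy⟩ := hy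
      · cases hy
      · cases hy
      · cases hxy
        simp only [List.mem_map, CausalVertex.factor.injEq, exists_eq_right]
        tauto

theorem thins_keep_reverse {p u : List F} {q : List (CausalVertex F)} :
    Thins (Over S) q (u.reverse.map .factor) ((keep S p u).reverse.map .factor) := by
  induction u generalizing p q with
  | nil => exact .nil _
  | cons y u ih =>
    rw [keep, List.reverse_cons, List.map_append]
    split_ifs with h
    · rw [List.reverse_cons, List.map_append]
      exact ih.append (.keep (.nil _))
    · rw [← List.append_nil ((keep S (y :: p) u).reverse.map _)]
      refine ih.append (.drop (fun hy => ?_) (.nil _))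
      obtain hy | hy | ⟨x, hx, hxy⟩ := hy
      · cases hy
      · cases hy
      · cases hxy
        simp only [List.mem_append, List.mem_map, List.mem_reverse, CausalVertex.factor.injEq,
          exists_eq_right]
        tauto

omit [DecidableEq F] in
theorem firstTouch_cons_of_pos {l : List (CausalVertex F)} {a c : CausalVertex F}
    (h : R c a = true) : firstTouch R (c :: l) a = some c :=
  List.find?_cons_of_pos h

omit [DecidableEq F] in
theorem firstTouch_cons_of_neg {l : List (CausalVertex F)} {a c : CausalVertex F}
    (h : ¬ R c a = true) : firstTouch R (c :: l) a = firstTouch R l a :=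
  List.find?_cons_of_neg h

omit [DecidableEq F] in
theorem firstTouch_append (l l' : List (CausalVertex F)) (a : CausalVertex F) :
    firstTouch R (l ++ l') a = (firstTouch R l a).or (firstTouch R l' a) :=
  List.find?_append

/-- Reducing a word to the first and last occurrences of letters in `S` preserves parents over
`S`. -/
theorem firstTouch_keep {u v : List F} {a b : CausalVertex F}
    (h : firstTouch R (.root :: outwardWord u v) a = some b) (hb : Over S b) :
    firstTouch R (.root :: outwardWord (keep S v u) (keep S u v)) a = some b := by
  refine Thins.find?_eq (S := Over S) (p := []) (.keep ?_) (by simp) h hb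
  refine Thins.append thins_keep_reverse (.keep (thins_keep ?_))
  intro c hc
  simp only [List.mem_map, List.map_reverse, List.mem_append, List.mem_reverse,
    List.mem_cons] at hc ⊢
  exact Or.inr (Or.inl hc)

theorem allHarmless_iff {p v : List F} : AllHarmless R S p v ↔
    ∀ v₁ y v₂, v = v₁ ++ y :: v₂ → y ∉ S → Harmless R S (v₁ ++ p) v₂ y := by
  induction v generalizing p with
  | nil => simp [AllHarmless]
  | cons z v ih =>
    rw [AllHarmless, ih]
    constructor
    · rintro ⟨h, h'⟩ v₁ y v₂ hv hy
      cases v₁ with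
      | nil =>
        simp only [List.nil_append, List.cons.injEq] at hv
        obtain ⟨rfl, rfl⟩ := hv
        exact h hy
      | cons c v₁ =>
        simp only [List.cons_append, List.cons.injEq] at hv
        obtain ⟨rfl, rfl⟩ := hv
        exact (Harmless.congr (fun x _ => by simp; tauto) fun _ _ => Iff.rfl).1 (h' _ _ _ rfl hy)
    · intro h
      refine ⟨h [] z v rfl, fun v₁ y v₂ hv hy => ?_⟩
      exact (Harmless.congr (fun x _ => by simp; tauto) fun _ _ => Iff.rfl).1
        (h (z :: v₁) y v₂ (by rw [hv]; rfl) hy)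

/-- If all letters outside `S` are harmless, parents of vertices over `S` are over `S`. -/
theorem over_of_firstTouch (hR : R .root .root = true) {u v : List F} (hu : AllHarmless R S v u)
    (hv : AllHarmless R S u v) {a b : CausalVertex F} (ha : Over S a)
    (h : firstTouch R (.root :: outwardWord u v) a = some b) : Over S b := by
  by_cases hra : R .root a = true
  · rw [firstTouch_cons_of_pos hra, Option.some_inj] at h
    exact Or.inl h.symm
  have ha' : a = .target ∨ ∃ x ∈ S, a = .factor x := by
    obtain rfl | ha := ha
    · exact absurd hR hra
    · exact ha
  rw [firstTouch_cons_of_neg hra, outwardWord] at h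
  obtain ⟨hba, as, bs, hw, has⟩ := List.find?_eq_some_iff_append.1 h
  have has' : ∀ c ∈ as, ¬ R c a = true := fun c hc => by simpa using has c hc
  cases b with
  | root => exact Or.inl rfl
  | target => exact Or.inr (Or.inl rfl)
  | factor y =>
    refine Or.inr (Or.inr ⟨y, by_contra fun hy => ?_, rfl⟩)
    obtain ⟨cs, hc1, hc2⟩ | ⟨cs, hc1, hc2⟩ := List.append_eq_append_iff.1 hw
    · -- The factor `y` stands after the target.
      cases cs with
      | nil => simp at hc2
      | cons c cs =>
        simp only [List.cons_append, List.cons.injEq] at hc2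
        obtain ⟨rfl, hc2⟩ := hc2
        obtain ⟨v₁, v₂, rfl, h1, h2⟩ := List.map_eq_append_iff.1 hc2
        obtain ⟨z, v₂, rfl, hz, h3⟩ := List.map_eq_cons_iff.1 h2
        cases hz
        obtain h4 | h4 | ⟨x, hx, hxp, hxa⟩ := (allHarmless_iff.1 hv _ _ _ rfl hy a ha' hba).1
        · exact hra h4
        · exact has' .target (by simp [hc1]) h4
        · refine has' (.factor x) ?_ hxa
          simp only [hc1, ← h1]
          simp at hxp ⊢
          tauto
    · -- The factor `y` stands before the target.
      cases cs with
      | nil => simp at hc2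
      | cons c cs =>
        simp only [List.cons_append, List.cons.injEq] at hc2
        obtain ⟨rfl, hc2⟩ := hc2
        obtain ⟨u₁, u₂, hu', h1, h2⟩ := List.map_eq_append_iff.1 hc1
        obtain ⟨z, u₂, rfl, hz, h3⟩ := List.map_eq_cons_iff.1 h2
        cases hz
        have hu'' : u = u₂.reverse ++ y :: u₁.reverse := by
          rw [← List.reverse_reverse u, hu']
          simp
        obtain h4 | ⟨x, hx, hxp, hxa⟩ := (allHarmless_iff.1 hu _ _ _ hu'' hy a ha' hba).2
        · exact hra h4
        · refine has' (.factor x) ?_ hxa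
          simpa [← h1] using hxp

omit [DecidableEq F] in
theorem Core.swap {u v : List F} {a : CausalVertex F} (h : Core R u v a) : Core R v u a := by
  induction h with
  | target => exact .target
  | right _ h ih => exact .left ih h
  | left _ h ih => exact .right ih h

omit [DecidableEq F] in
theorem mem_outwardWord {u v : List F} {a : CausalVertex F} :
    a ∈ outwardWord u v ↔ a = .target ∨ ∃ x, (x ∈ u ∨ x ∈ v) ∧ a = .factor x := by
  simp only [outwardWord, List.mem_append, List.mem_map, List.mem_reverse, List.mem_cons]
  constructor
  · rintro (⟨x, hx, rfl⟩ | rfl | ⟨x, hx, rfl⟩)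
    · exact Or.inr ⟨x, Or.inl hx, rfl⟩
    · exact Or.inl rfl
    · exact Or.inr ⟨x, Or.inr hx, rfl⟩
  · rintro (rfl | ⟨x, hx | hx, rfl⟩)
    · exact Or.inr (Or.inl rfl)
    · exact Or.inl ⟨x, hx, rfl⟩
    · exact Or.inr (Or.inr ⟨x, hx, rfl⟩)

theorem Core.over {u v : List F} {a : CausalVertex F} (h : Core R u v a) :
    Over (u ++ v).toFinset a := by
  have key : ∀ b, b ∈ CausalVertex.root :: outwardWord u v → Over (u ++ v).toFinset b := by
    intro b hb
    rw [List.mem_cons, mem_outwardWord] at hb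
    simpa [Over] using hb
  cases h with
  | target => exact Or.inr (Or.inl rfl)
  | right _ h => exact key _ (List.mem_of_find?_eq_some h)
  | left _ h =>
    refine key _ ?_
    have := List.mem_of_find?_eq_some h
    rw [List.mem_cons, mem_outwardWord] at this ⊢
    simpa [or_comm] using this

/-- A reduced two-sided word: it creeps when read from either side, no letter occurs more than
twice, and all letters belong to the core. -/
structure IsReduced (R : CausalVertex F → CausalVertex F → Bool) (ψ : List F × List F) : Prop where
  count_le : ∀ x, (ψ.1 ++ ψ.2).count x ≤ 2
  creeps_right : Creeps R (outwardWord ψ.1 ψ.2)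
  creeps_left : Creeps R (outwardWord ψ.2 ψ.1)
  core : ∀ x ∈ ψ.1 ++ ψ.2, Core R ψ.1 ψ.2 (.factor x)

/-- The number of ways to obtain the two-sided word `(u, v)` by filling the gaps of `ψ`. -/
noncomputable def multiplicity (R : CausalVertex F → CausalVertex F → Bool) (ψ : List F × List F)
    (u v : List F) : ℕ :=
  fillings R (ψ.1 ++ ψ.2).toFinset ψ.2 ψ.1 u * fillings R (ψ.1 ++ ψ.2).toFinset ψ.1 ψ.2 v

/-- If `(u, v)` arises from the reduced word `ψ` by filling gaps, then its core consists of the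
letters of `ψ`. -/
theorem IsReduced.core_iff (hR : R .root .root = true) {ψ : List F × List F} (hψ : IsReduced R ψ)
    {u v : List F} (hS : (ψ.1 ++ ψ.2).toFinset = S) (hu : AllHarmless R S v u)
    (hv : AllHarmless R S u v)
    (h1 : ψ.1 = keep S v u) (h2 : ψ.2 = keep S u v) (x : F) :
    Core R u v (.factor x) ↔ x ∈ S := by
  have up : ∀ a, Core R u v a → Over S a := by
    intro a ha
    induction ha with
    | target => exact Or.inr (Or.inl rfl)
    | right _ h ih => exact over_of_firstTouch hR hu hv ih h
    | left _ h ih => exact over_of_firstTouch hR hv hu ih h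
  constructor
  · intro h
    obtain h | h | ⟨y, hy, h⟩ := up _ h
    · cases h
    · cases h
    · cases h; exact hy
  · intro hx
    -- parents over `S` exist in the long word because they exist in the reduced one
    have step : ∀ {u v : List F} {w w' : List F}, w = keep S v u → w' = keep S u v →
        AllHarmless R S v u → AllHarmless R S u v → ∀ {a b : CausalVertex F}, Over S a →
        firstTouch R (.root :: outwardWord w w') a = some b →
        firstTouch R (.root :: outwardWord u v) a = some b := by
      intro u v w w' hw hw' hu hv a b ha h
      have hb : R b a = true := by simpa using List.find?_some h
      have hmem : b ∈ CausalVertex.root :: outwardWord u v := by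
        have := List.mem_of_find?_eq_some h
        rw [hw, hw'] at this
        simp only [List.mem_cons, mem_outwardWord, mem_keep] at this ⊢
        obtain h | h | ⟨x, hx, h⟩ := this
        · exact Or.inl h
        · exact Or.inr (Or.inl h)
        · exact Or.inr (Or.inr ⟨x, by tauto, h⟩)
      have hex : (firstTouch R (.root :: outwardWord u v) a).isSome := by
        rw [firstTouch, List.find?_isSome]
        exact ⟨b, hmem, hb⟩
      obtain ⟨c, hc⟩ := Option.isSome_iff_exists.1 hex
      have := firstTouch_keep hc (over_of_firstTouch hR hu hv ha hc)
      rw [← hw, ← hw', h] at this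
      rw [hc, this]
    have down : ∀ a, Core R ψ.1 ψ.2 a → Core R u v a := by
      intro a ha
      induction ha with
      | target => exact .target
      | right ha h ih => exact .right ih (step h1 h2 hu hv (hS ▸ ha.over) h)
      | left ha h ih => exact .left ih (step h2 h1 hv hu (hS ▸ ha.over) h)
    exact down _ (hψ.core x (by rw [← hS] at hx; simpa using hx))

open scoped Classical in
theorem IsReduced.multiplicity_eq {ψ : List F × List F} (hψ : IsReduced R ψ) (u v : List F) :
    multiplicity R ψ u v =
      if ψ.1 = keep (ψ.1 ++ ψ.2).toFinset v u ∧ ψ.2 = keep (ψ.1 ++ ψ.2).toFinset u v ∧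
        AllHarmless R (ψ.1 ++ ψ.2).toFinset v u ∧ AllHarmless R (ψ.1 ++ ψ.2).toFinset u v
      then 1 else 0 := by
  set S := (ψ.1 ++ ψ.2).toFinset with hS
  have hS1 : ∀ x ∈ ψ.1, x ∈ S := fun x hx => by simp [hS, hx]
  have hS2 : ∀ x ∈ ψ.2, x ∈ S := fun x hx => by simp [hS, hx]
  have hc : ∀ x, (ψ.2 ++ ψ.1).count x ≤ 2 := fun x => by
    have := hψ.count_le x
    simp only [List.count_append] at this ⊢
    omega
  by_cases hm : (∀ x ∈ S, x ∈ u ↔ x ∈ ψ.1) ∧ ∀ x ∈ S, x ∈ v ↔ x ∈ ψ.2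
  · rw [multiplicity, ← hS, fillings_eq_ite v ψ.2 ψ.1 u hm.2 hS1 hc,
      fillings_eq_ite u ψ.1 ψ.2 v hm.1 hS2 hψ.count_le, ite_zero_mul_ite_zero, one_mul]
    refine if_congr ?_ rfl rfl
    tauto
  · rw [if_neg]
    · by_contra h0
      rw [multiplicity, ← hS] at h0
      obtain ⟨hu0, hv0⟩ := mul_ne_zero_iff.1 h0
      exact hm ⟨fun x hx => mem_iff_of_fillings_ne_zero hu0 hx,
        fun x hx => mem_iff_of_fillings_ne_zero hv0 hx⟩
    · rintro ⟨h1, h2, -⟩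
      refine hm ⟨fun x hx => ?_, fun x hx => ?_⟩
      · rw [h1, mem_keep]; tauto
      · rw [h2, mem_keep]; tauto

/-- The reduction of a creeping word to the first and last occurrences of the letters in its core
is a reduced word. -/
theorem isReduced_keep {u v : List F}
    (hr : Creeps R (outwardWord u v)) (hl : Creeps R (outwardWord v u))
    (hS : ∀ x, x ∈ S ↔ Core R u v (.factor x)) : IsReduced R (keep S v u, keep S u v) := by
  have ov : ∀ a, Core R u v a → Over S a := by
    intro a ha
    cases a with
    | root => exact Or.inl rfl
    | target => exact Or.inr (Or.inl rfl)
    | factor x => exact Or.inr (Or.inr ⟨x, (hS x).2 ha, rfl⟩)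
  have creep : ∀ {u v : List F}, Creeps R (outwardWord u v) →
      (∀ x, x ∈ S → Core R u v (.factor x)) → (∀ a, Core R u v a → Over S a) →
      Creeps R (outwardWord (keep S v u) (keep S u v)) := by
    intro u v hr hS hov a ha
    have ha' : a ∈ outwardWord u v ∧ Core R u v a := by
      rw [mem_outwardWord] at ha ⊢
      obtain rfl | ⟨x, hx, rfl⟩ := ha
      · exact ⟨Or.inl rfl, .target⟩
      · simp only [mem_keep] at hx
        exact ⟨Or.inr ⟨x, by tauto, rfl⟩, hS x (by tauto)⟩
    obtain ⟨b, hb, hne⟩ := hr a ha'.1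
    exact ⟨b, firstTouch_keep hb (hov b (.right ha'.2 hb)), hne⟩
  refine ⟨fun x => ?_, creep hr (fun x => (hS x).1) ov,
    creep hl (fun x hx => ((hS x).1 hx).swap) fun a ha => ov a ha.swap, fun x hx => ?_⟩
  · have h1 := count_keep_le (S := S) v u x
    have h2 := count_keep_le (S := S) u v x
    have h3 : x ∉ u → (keep S v u).count x = 0 := fun h => by
      rw [List.count_eq_zero, mem_keep]; tauto
    have h4 : x ∉ v → (keep S u v).count x = 0 := fun h => by
      rw [List.count_eq_zero, mem_keep]; tauto
    simp only [List.count_append]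
    split_ifs at h1 h2 with h5 h6 h6
    · omega
    · have := h3 h6; omega
    · have := h4 h5; omega
    · have := h3 h6; omega
  · have hx' : Core R u v (.factor x) := by
      simp only [List.mem_append, mem_keep] at hx
      exact (hS x).1 (by tauto)
    have key : ∀ a, Core R u v a → Core R (keep S v u) (keep S u v) a := by
      intro a ha
      induction ha with
      | target => exact .target
      | right ha h ih => exact .right ih (firstTouch_keep h (ov _ (.right ha h)))
      | left ha h ih => exact .left ih (firstTouch_keep h (ov _ (.left ha h)))
    exact key _ hx'

/-- Letters outside the core of a creeping word are harmless. -/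
theorem allHarmless_of_creeps {u v : List F}
    (hr : Creeps R (outwardWord u v)) (hl : Creeps R (outwardWord v u))
    (hS : ∀ x, x ∈ S ↔ Core R u v (.factor x)) : AllHarmless R S u v := by
  rw [allHarmless_iff]
  rintro v₁ y v₂ rfl hy a ha hya
  have hac : Core R u (v₁ ++ y :: v₂) a := by
    obtain rfl | ⟨x, hx, rfl⟩ := ha
    · exact .target
    · exact (hS x).1 hx
  have haw : a ∈ outwardWord u (v₁ ++ y :: v₂) := by
    rw [mem_outwardWord]
    obtain h | h | ⟨x, hx, h⟩ := hac.over
    · subst h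
      simp at ha
    · exact Or.inl h
    · exact Or.inr ⟨x, by rwa [List.mem_toFinset, List.mem_append] at hx, h⟩
  have haw' : a ∈ outwardWord (v₁ ++ y :: v₂) u := by
    rw [mem_outwardWord] at haw ⊢
    simpa only [or_comm (a := _ ∈ u)] using haw
  constructor
  · obtain ⟨b, hb, -⟩ := hr a haw
    have hbc := Core.right hac hb
    have hba : R b a = true := by simpa using List.find?_some hb
    have hpre : b = .root ∨ b ∈ outwardWord u v₁ := by
      have e : CausalVertex.root :: outwardWord u (v₁ ++ y :: v₂) =
          (.root :: outwardWord u v₁) ++ .factor y :: v₂.map .factor := by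
        simp [outwardWord]
      rw [e, firstTouch_append, firstTouch_cons_of_pos hya] at hb
      cases h : firstTouch R (.root :: outwardWord u v₁) a with
      | none =>
        rw [h, Option.none_or, Option.some_inj] at hb
        subst hb
        exact absurd ((hS y).2 hbc) hy
      | some c =>
        rw [h, Option.some_or, Option.some_inj] at hb
        subst hb
        simpa using List.mem_of_find?_eq_some h
    rw [mem_outwardWord] at hpre
    obtain rfl | rfl | ⟨x, hx, rfl⟩ := hpre
    · exact Or.inl hba
    · exact Or.inr (Or.inl hba)
    · exact Or.inr (Or.inr ⟨x, (hS x).2 hbc, by simpa [or_comm] using hx, hba⟩)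
  · obtain ⟨b, hb, -⟩ := hl a haw'
    have hbc := Core.left hac hb
    have hba : R b a = true := by simpa using List.find?_some hb
    have hpre : b = .root ∨ ∃ x ∈ v₂, b = .factor x := by
      have e : CausalVertex.root :: outwardWord (v₁ ++ y :: v₂) u =
          (.root :: v₂.reverse.map .factor) ++ .factor y ::
            (v₁.reverse.map .factor ++ .target :: u.map .factor) := by
        simp [outwardWord]
      rw [e, firstTouch_append, firstTouch_cons_of_pos hya] at hb
      cases h : firstTouch R (.root :: v₂.reverse.map .factor) a with
      | none =>
        rw [h, Option.none_or, Option.some_inj] at hb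
        subst hb
        exact absurd ((hS y).2 hbc) hy
      | some c =>
        rw [h, Option.some_or, Option.some_inj] at hb
        subst hb
        have := List.mem_of_find?_eq_some h
        simp only [List.mem_cons, List.mem_map, List.mem_reverse] at this
        obtain h | ⟨x, hx, h⟩ := this
        · exact Or.inl h
        · exact Or.inr ⟨x, hx, h.symm⟩
    obtain rfl | ⟨x, hx, rfl⟩ := hpre
    · exact Or.inl hba
    · exact Or.inr ⟨x, (hS x).2 hbc, hx, hba⟩

/-- Every creeping two-sided word arises from exactly one reduced word by filling gaps, and in
exactly one way. -/
theorem exists_isReduced (hR : R .root .root = true) {u v : List F}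
    (hr : Creeps R (outwardWord u v)) (hl : Creeps R (outwardWord v u)) :
    ∃ ψ, IsReduced R ψ ∧ multiplicity R ψ u v = 1 ∧
      ∀ χ, IsReduced R χ → χ ≠ ψ → multiplicity R χ u v = 0 := by
  classical
  obtain ⟨S, hS⟩ : ∃ S : Finset F, ∀ x, x ∈ S ↔ Core R u v (.factor x) :=
    ⟨(u ++ v).toFinset.filter fun x => Core R u v (.factor x), fun x => by
      rw [Finset.mem_filter, and_iff_right_iff_imp]
      intro h
      obtain h | h | ⟨y, hy, h⟩ := h.over
      · cases h
      · cases h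
      · cases h; exact hy⟩
  have hψ := isReduced_keep hr hl hS
  have hletters : ((keep S v u, keep S u v).1 ++ (keep S v u, keep S u v).2).toFinset = S := by
    ext x
    simp only [List.toFinset_append, Finset.mem_union, List.mem_toFinset, mem_keep]
    constructor
    · tauto
    · intro hx
      obtain h | h | ⟨y, hy, h⟩ := ((hS x).1 hx).over
      · cases h
      · cases h
      · cases h
        have : x ∈ u ∨ x ∈ v := by simpa using hy
        tauto
  refine ⟨_, hψ, ?_, fun χ hχ hne => ?_⟩
  · rw [hψ.multiplicity_eq, hletters, if_pos]
    exact ⟨rfl, rfl, allHarmless_of_creeps hl hr fun x => (hS x).trans ⟨.swap, .swap⟩,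
      allHarmless_of_creeps hr hl hS⟩
  · rw [hχ.multiplicity_eq, if_neg]
    rintro ⟨h1, h2, h3, h4⟩
    have hSχ : (χ.1 ++ χ.2).toFinset = S := by
      ext x
      rw [← hχ.core_iff hR rfl h3 h4 h1 h2, hS]
    rw [hSχ] at h1 h2
    exact hne (Prod.ext h1 h2)

end Partition

end OperatorGrowth

/-! ### Causal forests of creeping words -/

namespace OperatorGrowth

section Forests

variable {V F : Type*} [DecidableEq V]

/-- Two vertices touch if they have a node in common. -/
def touches (supp : F → Finset V) (i j : V) (b a : CausalVertex F) : Bool :=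
  decide (nodes supp i j b ∩ nodes supp i j a).Nonempty

variable [DecidableEq F] {supp : F → Finset V} {i j : V}

theorem attach_eq (seen : List (CausalVertex F)) (T : CausalGraph F) (a : CausalVertex F) :
    attach supp i j seen T a = if a ∈ seen then T else
      match firstTouch (touches supp i j) seen a with
      | some b => T ⊔ (⊤ : CausalGraph F).induce {b, a}
      | none => T ⊔ SimpleGraph.singletonSubgraph _ a := rfl

theorem mem_verts_attach {seen : List (CausalVertex F)} {T : CausalGraph F} {a : CausalVertex F}
    (hT : ∀ x, x ∈ T.verts ↔ x ∈ seen) (x : CausalVertex F) :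
    x ∈ (attach supp i j seen T a).verts ↔ x ∈ seen ++ [a] := by
  rw [attach_eq]
  split_ifs with h
  · rw [hT]
    simp only [List.mem_append, List.mem_singleton]
    exact ⟨Or.inl, by rintro (h | rfl) <;> assumption⟩
  · split
    · rename_i b hb
      have : b ∈ seen := List.mem_of_find?_eq_some hb
      simp only [SimpleGraph.Subgraph.verts_sup, SimpleGraph.Subgraph.induce_verts, Set.mem_union,
        hT, Set.mem_insert_iff, Set.mem_singleton_iff, List.mem_append, List.mem_singleton]
      constructor
      · rintro (h | rfl | rfl) <;> tauto
      · tauto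
    · simp [hT, or_comm]

theorem mem_verts_grow {seen w : List (CausalVertex F)} {T : CausalGraph F}
    (hT : ∀ x, x ∈ T.verts ↔ x ∈ seen) (x : CausalVertex F) :
    x ∈ (grow supp i j seen T w).verts ↔ x ∈ seen ++ w := by
  induction w generalizing seen T with
  | nil => simp [grow, hT]
  | cons a w ih => rw [grow, ih (mem_verts_attach hT)]; simp

theorem mem_verts_causalForest {w : List (CausalVertex F)} {x : CausalVertex F} :
    x ∈ (causalForest supp i j w).verts ↔ x ∈ .root :: w :=
  mem_verts_grow (by simp) x

/-- `b` is the vertex to which `a` is joined in the causal forest with vertices `l`. -/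
def IsParent (R : CausalVertex F → CausalVertex F → Bool) (l : List (CausalVertex F))
    (a b : CausalVertex F) : Prop :=
  a ≠ .root ∧ firstTouch R l a = some b

/-- The invariant under which the causal forest is built: the edges are those from the vertices
seen so far to their parents, which later entries do not change. -/
theorem grow_spec {seen w : List (CausalVertex F)} {T : CausalGraph F}
    (hw : ∀ a ∈ w, a ≠ .root → ∃ b, firstTouch (touches supp i j) (seen ++ w) a = some b ∧ b ≠ a)
    (hroot : .root ∈ seen)
    (hT : ∀ x, x ∈ T.verts ↔ x ∈ seen) (hc : T.Connected)
    (hA : ∀ x y, T.Adj x y ↔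
      x ∈ seen ∧ IsParent (touches supp i j) (seen ++ w) x y ∨
      y ∈ seen ∧ IsParent (touches supp i j) (seen ++ w) y x) :
    (grow supp i j seen T w).Connected ∧ ∀ x y, (grow supp i j seen T w).Adj x y ↔
      x ∈ seen ++ w ∧ IsParent (touches supp i j) (seen ++ w) x y ∨
      y ∈ seen ++ w ∧ IsParent (touches supp i j) (seen ++ w) y x := by
  induction w generalizing seen T with
  | nil => simpa [grow] using ⟨hc, by simpa using hA⟩
  | cons a w ih =>
    have e : seen ++ a :: w = (seen ++ [a]) ++ w := by simp
    rw [grow, e]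
    refine ih (fun c hcw hr => e ▸ hw c (by simp [hcw]) hr) (by simp [hroot])
      (mem_verts_attach hT) ?_ ?_
    · rw [attach_eq]
      split_ifs with h
      · exact hc
      · split
        · rename_i b hb
          have hbs : b ∈ seen := List.mem_of_find?_eq_some hb
          have hba : (⊤ : SimpleGraph (CausalVertex F)).Adj b a := by
            rw [SimpleGraph.top_adj]
            rintro rfl
            exact h hbs
          refine SimpleGraph.Subgraph.connected_sup hc.preconnected
            (SimpleGraph.Subgraph.top_induce_pair_connected_of_adj hba).preconnected ⟨b, ?_⟩
          simp [hT, hbs]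
        · rename_i hb
          exfalso
          obtain ⟨b, hb', hne⟩ := hw a (by simp) (fun h' => h (h' ▸ hroot))
          rw [firstTouch_append, hb, Option.none_or] at hb'
          by_cases haa : touches supp i j a a = true
          · rw [firstTouch_cons_of_pos haa, Option.some_inj] at hb'
            exact hne hb'.symm
          · have hba : touches supp i j b a = true := by simpa using List.find?_some hb'
            apply haa
            simp only [touches, decide_eq_true_eq, Finset.inter_self] at hba ⊢
            exact hba.mono Finset.inter_subset_right
    · intro x y
      rw [← e, attach_eq]
      by_cases h : a ∈ seen
      · have hs : ∀ z, z ∈ seen ++ [a] ↔ z ∈ seen := fun z => by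
          simp only [List.mem_append, List.mem_singleton]
          exact ⟨by rintro (h | rfl) <;> assumption, Or.inl⟩
        rw [if_pos h, hs, hs, hA]
      · have har : a ≠ .root := fun h' => h (h' ▸ hroot)
        obtain ⟨b, hb', hne⟩ := hw a (by simp) har
        have hb : firstTouch (touches supp i j) seen a = some b := by
          rw [firstTouch_append] at hb'
          cases hs : firstTouch (touches supp i j) seen a with
          | some c => rwa [hs, Option.some_or] at hb'
          | none =>
            rw [hs, Option.none_or] at hb'
            by_cases haa : touches supp i j a a = true
            · rw [firstTouch_cons_of_pos haa, Option.some_inj] at hb'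
              exact absurd hb'.symm hne
            · have hba : touches supp i j b a = true := by simpa using List.find?_some hb'
              exfalso
              apply haa
              simp only [touches, decide_eq_true_eq, Finset.inter_self] at hba ⊢
              exact hba.mono Finset.inter_subset_right
        rw [if_neg h, hb]
        have hpa : ∀ z, IsParent (touches supp i j) (seen ++ a :: w) a z ↔ z = b := fun z => by
          simp only [IsParent, hb', Option.some_inj]
          exact ⟨fun h => h.2.symm, fun h => ⟨har, h.symm⟩⟩
        simp only [SimpleGraph.Subgraph.sup_adj, hA, SimpleGraph.Subgraph.induce_adj,
          Set.mem_insert_iff, Set.mem_singleton_iff, SimpleGraph.Subgraph.top_adj,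
          SimpleGraph.top_adj, List.mem_append, List.mem_singleton]
        constructor
        · rintro ((⟨h1, h2⟩ | ⟨h1, h2⟩) | ⟨rfl | rfl, rfl | rfl, h3⟩)
          · exact Or.inl ⟨Or.inl h1, h2⟩
          · exact Or.inr ⟨Or.inl h1, h2⟩
          · exact absurd rfl h3
          · exact Or.inr ⟨Or.inr rfl, (hpa _).2 rfl⟩
          · exact Or.inl ⟨Or.inr rfl, (hpa _).2 rfl⟩
          · exact absurd rfl h3
        · rintro (⟨h1 | rfl, h2⟩ | ⟨h1 | rfl, h2⟩)
          · exact Or.inl (Or.inl ⟨h1, h2⟩)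
          · rw [hpa] at h2
            subst h2
            exact Or.inr ⟨Or.inr rfl, Or.inl rfl, hne.symm⟩
          · exact Or.inl (Or.inr ⟨h1, h2⟩)
          · rw [hpa] at h2
            subst h2
            exact Or.inr ⟨Or.inl rfl, Or.inr rfl, hne⟩

/-- The causal forest of a creeping word is connected, and its edges join the entries to the first
entries touching them. -/
theorem causalForest_spec {w : List (CausalVertex F)} (hw : Creeps (touches supp i j) w) :
    (causalForest supp i j w).Connected ∧ ∀ x y, (causalForest supp i j w).Adj x y ↔
      x ∈ .root :: w ∧ IsParent (touches supp i j) (.root :: w) x y ∨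
      y ∈ .root :: w ∧ IsParent (touches supp i j) (.root :: w) y x := by
  refine grow_spec (fun a ha _ => hw a ha) (by simp) (by simp)
    SimpleGraph.Subgraph.singletonSubgraph_connected fun x y => ?_
  have hr : ∀ {x y : CausalVertex F} {l}, x ∈ [CausalVertex.root] →
      IsParent (touches supp i j) l x y → False := fun hx h => h.1 (by simpa using hx)
  constructor
  · intro h
    exact absurd h (by simp)
  · rintro (⟨h1, h2⟩ | ⟨h1, h2⟩) <;> exact (hr h1 h2).elim

omit [DecidableEq F] in
/-- A connected subgraph of a graph whose edges join vertices to their parents contains, with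
each vertex `a` and with the root, the edge from `a` to its parent: no other edge leaves the set of
the descendants of `a`. -/
theorem adj_of_isParent {R : CausalVertex F → CausalVertex F → Bool} {l : List (CausalVertex F)}
    {T : CausalGraph F} (hT : T.Connected) (hr : .root ∈ T.verts)
    (hA : ∀ x y, T.Adj x y → IsParent R l x y ∨ IsParent R l y x) {a b : CausalVertex F}
    (ha : a ∈ T.verts) (hab : IsParent R l a b) : T.Adj a b := by
  let D : Set T.verts := {c | Relation.ReflTransGen (IsParent R l) c a}
  have hroot : (⟨.root, hr⟩ : T.verts) ∉ D := by
    intro h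
    obtain h | ⟨c, h, -⟩ := h.cases_head
    · exact hab.1 h.symm
    · exact h.1 rfl
  obtain ⟨p⟩ := hT.coe.preconnected ⟨a, ha⟩ ⟨.root, hr⟩
  obtain ⟨e, -, h1, h2⟩ := p.exists_boundary_dart D Relation.ReflTransGen.refl hroot
  obtain ⟨⟨c, c'⟩, hadj⟩ := e
  replace hadj : T.Adj c c' := hadj
  obtain h | h := hA _ _ hadj
  · obtain h' | ⟨d, h', h''⟩ := Relation.ReflTransGen.cases_head h1
    · have hc : (c : CausalVertex F) = a := h'
      rw [hc] at h hadj
      have : (c' : CausalVertex F) = b := Option.some_injective _ (h.2.symm.trans hab.2)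
      rwa [this] at hadj
    · have : d = c' := Option.some_injective _ (h'.2.symm.trans h.2)
      exact absurd (show Relation.ReflTransGen (IsParent R l) c' a from this ▸ h'') h2
  · exact absurd (Relation.ReflTransGen.head h h1) h2

omit [DecidableEq F] in
theorem TwoSided.readRight_eq (M : TwoSided F) :
    M.readRight = outwardWord M.right.reverse M.left := by
  simp [TwoSided.readRight, outwardWord]

omit [DecidableEq F] in
theorem TwoSided.readLeft_eq (M : TwoSided F) :
    M.readLeft = outwardWord M.left M.right.reverse := rfl

theorem mem_factorSet_causalForest [Fintype F] {u v : List F} {x : F} :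
    x ∈ factorSet (causalForest supp i j (outwardWord u v)) ↔ x ∈ u ∨ x ∈ v := by
  simp [factorSet, mem_verts_causalForest, mem_outwardWord]

/-- A reduced word in which every letter occurs twice is an ordering of an irreducible causal tree
pair. -/
theorem IsReduced.mem_orderings [Fintype F] (hij : i ≠ j) {M : TwoSided F}
    (h : IsReduced (touches supp i j) (M.right.reverse, M.left))
    (h2 : ∀ x ∈ M.factors, M.factors.count x = 2) :
    treePair supp i j M ∈ irreducibleTreePairs supp i j ∧
      M ∈ orderings supp i j (treePair supp i j M) := by
  have specR := causalForest_spec h.creeps_right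
  have specL := causalForest_spec h.creeps_left
  have hM : M ∈ creepingSequences supp i j := by
    refine ⟨fun x hx => (h2 x hx).ge, ?_, ?_, ?_⟩
    · obtain ⟨b, hb, hne⟩ := h.creeps_right .target (by simp [mem_outwardWord])
      have hbt : touches supp i j b .target = true := by simpa using List.find?_some hb
      have hbm := List.mem_of_find?_eq_some hb
      rw [List.mem_cons, mem_outwardWord] at hbm
      obtain rfl | rfl | ⟨x, hx, rfl⟩ := hbm
      · simp [touches, nodes, hij] at hbt
      · exact absurd rfl hne
      · refine ⟨x, by simpa [TwoSided.factors] using hx, ?_⟩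
        obtain ⟨k, hk⟩ := of_decide_eq_true hbt
        simp only [nodes, Finset.mem_inter, Finset.mem_singleton] at hk
        exact hk.2 ▸ hk.1
    · exact specL.1
    · simp only [treePair, TwoSided.readRight_eq]
      exact specR.1
  refine ⟨⟨⟨M, hM, rfl⟩, ?_⟩, hM, rfl, ?_⟩
  · -- A smaller causal tree pair contains the core, which is everything.
    rintro _ ⟨M', hM', rfl⟩ hle
    have hcL : (causalForest supp i j M'.readLeft).Connected := hM'.2.2.1
    have hcR : (causalForest supp i j M'.readRight).Connected := hM'.2.2.2
    obtain ⟨hleL, hleR⟩ := hle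
    simp only [treePair, TwoSided.readRight_eq, TwoSided.readLeft_eq] at hleL hleR hcL hcR ⊢
    have hverts : ∀ x, x ∈ (causalForest supp i j
        (outwardWord M'.left M'.right.reverse)).verts ↔
        x ∈ (causalForest supp i j (outwardWord M'.right.reverse M'.left)).verts := fun x => by
      simp only [mem_verts_causalForest, List.mem_cons, mem_outwardWord, or_comm]
    have hadjR : ∀ {a b}, a ∈ (causalForest supp i j
        (outwardWord M'.right.reverse M'.left)).verts →
        IsParent (touches supp i j) (.root :: outwardWord M.right.reverse M.left) a b →
        (causalForest supp i j (outwardWord M'.right.reverse M'.left)).Adj a b := by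
      intro a b ha hab
      refine adj_of_isParent hcR (by simp [mem_verts_causalForest]) (fun x y hxy => ?_) ha hab
      exact ((specR.2 x y).1 (hleR.2 hxy)).imp And.right And.right
    have hadjL : ∀ {a b}, a ∈ (causalForest supp i j
        (outwardWord M'.left M'.right.reverse)).verts →
        IsParent (touches supp i j) (.root :: outwardWord M.left M.right.reverse) a b →
        (causalForest supp i j (outwardWord M'.left M'.right.reverse)).Adj a b := by
      intro a b ha hab
      refine adj_of_isParent hcL (by simp [mem_verts_causalForest]) (fun x y hxy => ?_) ha hab
      exact ((specL.2 x y).1 (hleL.2 hxy)).imp And.right And.right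
    have hrr : touches supp i j (.root : CausalVertex F) .root = true := by
      simp [touches, nodes]
    have hcore : ∀ a, Core (touches supp i j) M.right.reverse M.left a →
        a ∈ (causalForest supp i j (outwardWord M'.right.reverse M'.left)).verts := by
      intro a ha
      induction ha with
      | target => simp [mem_verts_causalForest, mem_outwardWord]
      | @right a b _ hb ih =>
        by_cases har : a = .root
        · subst har
          rw [firstTouch_cons_of_pos hrr, Option.some_inj] at hb
          rwa [← hb]
        · exact (hadjR ih ⟨har, hb⟩).snd_mem
      | @left a b _ hb ih =>
        by_cases har : a = .root
        · subst har
          rw [firstTouch_cons_of_pos hrr, Option.some_inj] at hb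
          rwa [← hb]
        · exact (hverts _).1 (hadjL ((hverts _).2 ih) ⟨har, hb⟩).snd_mem
    have hall : ∀ a, (a = .root ∨ a = .target ∨ ∃ x, (x ∈ M.right.reverse ∨ x ∈ M.left) ∧
        a = .factor x) →
        a ∈ (causalForest supp i j (outwardWord M'.right.reverse M'.left)).verts := by
      rintro a (rfl | rfl | ⟨x, hx, rfl⟩)
      · simp [mem_verts_causalForest]
      · exact hcore _ .target
      · exact hcore _ (h.core x (List.mem_append.2 hx))
    have hallR : ∀ a, a ∈ CausalVertex.root :: outwardWord M.right.reverse M.left →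
        a ∈ (causalForest supp i j (outwardWord M'.right.reverse M'.left)).verts := fun a ha =>
      hall a (by rwa [List.mem_cons, mem_outwardWord] at ha)
    have hallL : ∀ a, a ∈ CausalVertex.root :: outwardWord M.left M.right.reverse →
        a ∈ (causalForest supp i j (outwardWord M'.left M'.right.reverse)).verts := fun a ha =>
      (hverts a).2 (hall a (by
        rw [List.mem_cons, mem_outwardWord] at ha
        simpa only [or_comm (a := _ ∈ M.left)] using ha))
    refine ⟨⟨fun a ha => hallL a (mem_verts_causalForest.1 ha), fun x y hxy => ?_⟩,
      ⟨fun a ha => hallR a (mem_verts_causalForest.1 ha), fun x y hxy => ?_⟩⟩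
    · obtain ⟨h1, h2⟩ | ⟨h1, h2⟩ := (specL.2 x y).1 hxy
      · exact hadjL (hallL _ h1) h2
      · exact (hadjL (hallL _ h1) h2).symm
    · obtain ⟨h1, h2⟩ | ⟨h1, h2⟩ := (specR.2 x y).1 hxy
      · exact hadjR (hallR _ h1) h2
      · exact (hadjR (hallR _ h1) h2).symm
  · have hset : factorSet (treePair supp i j M).1 = M.factors.toFinset := by
      ext x
      simp only [treePair, TwoSided.readLeft_eq, mem_factorSet_causalForest, List.mem_toFinset,
        TwoSided.factors, List.mem_append, List.mem_reverse, or_comm]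
    rw [hset, ← List.sum_toFinset_count_eq_length, Finset.sum_congr rfl fun x hx =>
      h2 x (List.mem_toFinset.1 hx), Finset.sum_const, smul_eq_mul, mul_comm]

end Forests

end OperatorGrowth

/-! ### Dyson series over words -/

namespace OperatorGrowth

section ExpSeries

variable {E : Type*} [NormedAddCommGroup E] [NormedSpace ℝ E]

/-- The exponential generating function `∑ n, tⁿ / n! • a n`. -/
noncomputable def expGen (a : ℕ → E) (t : ℝ) : E :=
  ∑' n, (t ^ n / (n ! : ℝ)) • a n

variable {a : ℕ → E} {M K : ℝ}

theorem summable_norm_expGen (ha : ∀ n, ‖a n‖ ≤ M * K ^ n) (t : ℝ) :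
    Summable fun n => ‖(t ^ n / (n ! : ℝ)) • a n‖ := by
  refine Summable.of_nonneg_of_le (fun _ => norm_nonneg _) (fun n => ?_)
    ((Real.summable_pow_div_factorial (|t| * K)).mul_left M)
  rw [norm_smul, norm_div, norm_pow, Real.norm_eq_abs, Real.norm_eq_abs, Nat.abs_cast, mul_pow]
  calc |t| ^ n / (n ! : ℝ) * ‖a n‖ ≤ |t| ^ n / (n ! : ℝ) * (M * K ^ n) := by gcongr; exact ha n
    _ = M * (|t| ^ n * K ^ n / (n ! : ℝ)) := by ring

theorem hasSum_expGen [CompleteSpace E] (ha : ∀ n, ‖a n‖ ≤ M * K ^ n) (t : ℝ) :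
    HasSum (fun n => (t ^ n / (n ! : ℝ)) • a n) (expGen a t) :=
  (summable_norm_expGen ha t).of_norm.hasSum

theorem expGen_zero : expGen a 0 = a 0 := by
  rw [expGen, tsum_eq_single 0 (fun n hn => by simp [hn])]
  simp

/-- Differentiation shifts the coefficients of an exponential generating function. -/
theorem hasDerivAt_expGen [CompleteSpace E] (ha : ∀ n, ‖a n‖ ≤ M * K ^ n) (t : ℝ) :
    HasDerivAt (expGen a) (expGen (fun n => a (n + 1)) t) t := by
  set r := |t| + 1
  have hr : 0 ≤ r := by positivity
  have hfac : ∀ (n : ℕ) (y : ℝ), ((n + 1 : ℕ) : ℝ) * y ^ n / ((n + 1)! : ℝ) = y ^ n / (n ! : ℝ) := by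
    intro n y
    rw [Nat.factorial_succ, Nat.cast_mul, mul_div_mul_left _ _ (by positivity)]
  have hu : Summable fun n : ℕ => (n * r ^ (n - 1) / (n ! : ℝ)) * (M * K ^ n) := by
    rw [← summable_nat_add_iff 1]
    refine ((Real.summable_pow_div_factorial (r * K)).mul_left (M * K)).congr fun n => ?_
    rw [Nat.add_sub_cancel, hfac, mul_pow]
    ring
  have hmem : t ∈ Metric.ball (0 : ℝ) r := by simp [r]
  have hd := hasDerivAt_tsum_of_isPreconnected (g := fun n z => (z ^ n / (n ! : ℝ)) • a n)
    (g' := fun n z => (n * z ^ (n - 1) / (n ! : ℝ)) • a n) hu Metric.isOpen_ball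
    (convex_ball (0 : ℝ) r).isPreconnected
    (fun n y _ => ((hasDerivAt_pow n y).div_const _).smul_const (a n))
    (fun n y hy => by
      have hy' : |y| ≤ r := by
        have := Metric.mem_ball.1 hy
        rw [Real.dist_eq, sub_zero] at this
        exact this.le
      rw [norm_smul, norm_div, norm_mul, norm_pow, Real.norm_eq_abs, Real.norm_eq_abs,
        Real.norm_eq_abs, Nat.abs_cast, Nat.abs_cast]
      gcongr
      exact ha n) hmem (summable_norm_expGen ha t).of_norm hmem
  refine hd.congr_deriv ?_
  have hs : Summable fun n : ℕ => ((n * t ^ (n - 1) / (n ! : ℝ)) • a n) := by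
    refine Summable.of_norm (Summable.of_nonneg_of_le (fun _ => norm_nonneg _) (fun n => ?_) hu)
    rw [norm_smul, norm_div, norm_mul, norm_pow, Real.norm_eq_abs, Real.norm_eq_abs,
      Real.norm_eq_abs, Nat.abs_cast, Nat.abs_cast]
    gcongr
    · simp [r]
    · exact ha n
  rw [hs.tsum_eq_zero_add]
  simp only [Nat.cast_zero, zero_mul, zero_div, zero_smul, zero_add, Nat.add_sub_cancel, hfac,
    expGen]

end ExpSeries

section Skew

open scoped InnerProductSpace

variable {E : Type*} [NormedAddCommGroup E] [InnerProductSpace ℝ E]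

/-- A norm bound for a forced linear evolution whose generator is skew and hence preserves the
norm. -/
theorem norm_le_of_skew_of_nonneg {B : E →L[ℝ] E} (hB : ∀ x, ⟪B x, x⟫_ℝ = 0) {D G : ℝ → E}
    (hD : ∀ s, HasDerivAt D (B (D s) + G s) s) {g g' : ℝ → ℝ} (hg : ∀ s, HasDerivAt g (g' s) s)
    (hg_nonneg : ∀ s, 0 ≤ s → 0 ≤ g s) (h0 : ‖D 0‖ ≤ g 0) (hG : ∀ s, 0 ≤ s → ‖G s‖ ≤ g' s)
    {t : ℝ} (ht : 0 ≤ t) : ‖D t‖ ≤ g t := by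
  -- The squared norms are compared, with a small strictly increasing term added to the bound.
  have key : ∀ ε : ℝ, 0 < ε → ‖D t‖ ≤ g t + ε * (1 + t) := by
    intro ε hε
    have hpos : ∀ s, 0 ≤ s → 0 < g s + ε * (1 + s) := fun s hs => by
      have := hg_nonneg s hs
      positivity
    have hb : ∀ s, HasDerivAt (fun s => (g s + ε * (1 + s)) ^ 2)
        (2 * (g s + ε * (1 + s)) * (g' s + ε)) s := fun s => by
      have h1 : HasDerivAt (fun s : ℝ => ε * (1 + s)) ε s := by
        simpa using ((hasDerivAt_id s).const_add 1).const_mul ε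
      refine (((hg s).add h1).pow 2).congr_deriv ?_
      simp
    have hcont : Continuous fun s => ‖D s‖ ^ 2 :=
      (continuous_iff_continuousAt.2 fun s => (hD s).continuousAt).norm.pow 2
    have := image_le_of_deriv_right_lt_deriv_boundary (f := fun s => ‖D s‖ ^ 2) (a := 0) (b := t)
      hcont.continuousOn (fun s _ => ((hD s).norm_sq).hasDerivWithinAt)
      (by
        have : ‖D 0‖ ≤ g 0 + ε * (1 + 0) := h0.trans (by linarith)
        gcongr)
      hb (fun s hs heq => by
        have hs0 := hs.1
        have hn : ‖D s‖ = g s + ε * (1 + s) :=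
          (sq_eq_sq₀ (norm_nonneg _) (hpos s hs0).le).1 heq
        have h1 : ⟪D s, B (D s) + G s⟫_ℝ ≤ ‖D s‖ * g' s := by
          rw [inner_add_right, real_inner_comm, hB, zero_add]
          exact (real_inner_le_norm _ _).trans
            (mul_le_mul_of_nonneg_left (hG s hs0) (norm_nonneg _))
        have h2 := mul_pos (hpos s hs0) hε
        rw [← hn] at h2 ⊢
        linarith) (Set.right_mem_Icc.2 ht)
    exact (sq_le_sq₀ (norm_nonneg _) (hpos t ht).le).1 this
  refine le_of_forall_pos_le_add fun δ hδ => ?_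
  have h := key (δ / (1 + t)) (by positivity)
  rwa [div_mul_cancel₀ _ (by positivity)] at h

theorem norm_le_of_skew {B : E →L[ℝ] E} (hB : ∀ x, ⟪B x, x⟫_ℝ = 0) {D G : ℝ → E}
    (hD : ∀ s, HasDerivAt D (B (D s) + G s) s) {c : ℝ} {m : ℕ} (h0 : D 0 = 0)
    (hc : 0 ≤ c) (hG : ∀ s, ‖G s‖ ≤ c * (|s| ^ m / (m ! : ℝ))) (t : ℝ) :
    ‖D t‖ ≤ c * (|t| ^ (m + 1) / ((m + 1)! : ℝ)) := by
  have hg : ∀ s : ℝ, HasDerivAt (fun s => c * (s ^ (m + 1) / ((m + 1)! : ℝ)))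
      (c * (s ^ m / (m ! : ℝ))) s := fun s => by
    refine (((hasDerivAt_pow (m + 1) s).div_const _).const_mul c).congr_deriv ?_
    rw [Nat.add_sub_cancel, Nat.factorial_succ, Nat.cast_mul, mul_div_mul_left _ _ (by positivity)]
  have hnn : ∀ s : ℝ, 0 ≤ s → 0 ≤ c * (s ^ (m + 1) / ((m + 1)! : ℝ)) := fun s hs => by positivity
  have h0' : ‖D 0‖ ≤ c * ((0 : ℝ) ^ (m + 1) / ((m + 1)! : ℝ)) := by simp [h0]
  obtain ht | ht := le_total 0 t
  · rw [abs_of_nonneg ht]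
    exact norm_le_of_skew_of_nonneg hB hD hg hnn h0'
      (fun s hs => by simpa [abs_of_nonneg hs] using hG s) ht
  · have hD' : ∀ s, HasDerivAt (fun s => D (-s)) ((-B) (D (-s)) + -G (-s)) s := fun s => by
      refine ((hD (-s)).scomp s (hasDerivAt_neg s)).congr_deriv ?_
      simp [add_comm]
    have := norm_le_of_skew_of_nonneg (B := -B) (fun x => by simp [hB]) hD' hg hnn
      (by simpa using h0')
      (fun s hs => by simpa [abs_of_nonneg hs] using hG (-s)) (neg_nonneg.2 ht)
    rw [abs_of_nonpos ht]
    simpa using this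

theorem norm_le_of_skew_of_const {B : E →L[ℝ] E} (hB : ∀ x, ⟪B x, x⟫_ℝ = 0) {D : ℝ → E}
    (hD : ∀ s, HasDerivAt D (B (D s)) s) (t : ℝ) : ‖D t‖ ≤ ‖D 0‖ := by
  obtain ht | ht := le_total 0 t
  · exact norm_le_of_skew_of_nonneg hB (G := 0) (by simpa using hD)
      (fun s => hasDerivAt_const s ‖D 0‖) (fun _ _ => norm_nonneg _) le_rfl (by simp) ht
  · have hD' : ∀ s, HasDerivAt (fun s => D (-s)) ((-B) (D (-s)) + (0 : ℝ → E) s) s := fun s => by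
      refine ((hD (-s)).scomp s (hasDerivAt_neg s)).congr_deriv ?_
      simp
    have := norm_le_of_skew_of_nonneg (B := -B) (fun x => by simp [hB]) hD'
      (fun s => hasDerivAt_const s ‖D 0‖) (fun _ _ => norm_nonneg _) (by simp) (by simp)
      (neg_nonneg.2 ht)
    simpa using this

end Skew

section SumWords

variable {F : Type*} [Fintype F] {G : Type*} [AddCommMonoid G]

/-- The sum of `f` over all words of length `n`. -/
def sumWords : ℕ → (List F → G) → G
  | 0, f => f []
  | n + 1, f => ∑ y, sumWords n fun w => f (y :: w)

theorem sumWords_sum {ι : Type*} (s : Finset ι) (n : ℕ) (f : ι → List F → G) :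
    sumWords n (fun w => ∑ k ∈ s, f k w) = ∑ k ∈ s, sumWords n (f k) := by
  induction n generalizing f with
  | zero => rfl
  | succ n ih =>
    simp only [sumWords, ih]
    exact Finset.sum_comm

theorem sumWords_zero (n : ℕ) : sumWords n (fun _ : List F => (0 : G)) = 0 := by
  induction n with
  | zero => rfl
  | succ n ih => simp [sumWords, ih]

theorem sumWords_add (n : ℕ) (f g : List F → G) :
    sumWords n (fun w => f w + g w) = sumWords n f + sumWords n g := by
  induction n generalizing f g with
  | zero => rfl
  | succ n ih => simp [sumWords, ih, Finset.sum_add_distrib]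

theorem map_sumWords {G' : Type*} [AddCommMonoid G'] (f : G →+ G') (n : ℕ) (g : List F → G) :
    f (sumWords n g) = sumWords n fun w => f (g w) := by
  induction n generalizing g with
  | zero => rfl
  | succ n ih => simp [sumWords, ih]

end SumWords

section Dyson

variable {F : Type*} [Fintype F] {E : Type*} [NormedAddCommGroup E] [InnerProductSpace ℝ E]

open scoped Classical in
/-- The generator `∑ y, J y • L y` restricted to the letters allowed in a gap. -/
noncomputable def gapGenerator (R : CausalVertex F → CausalVertex F → Bool) (S : Finset F)
    (L : F → E →L[ℝ] E) (J : F → ℝ) (C ψ : List F) : E →L[ℝ] E :=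
  ∑ y, if GapAllowed R S C ψ y then J y • L y else 0

/-- The sum over all words of length `n` that arise from `ψ` by filling gaps, of the product of the
operators of the letters applied to `A`. The couplings of the marked letters are left out. -/
noncomputable def dysonCoeff (R : CausalVertex F → CausalVertex F → Bool) (S : Finset F)
    (L : F → E →L[ℝ] E) (J : F → ℝ) (A : E) : ℕ → List F → List F → E
  | 0, _, [] => A
  | 0, _, _ :: _ => 0
  | n + 1, C, [] => gapGenerator R S L J C [] (dysonCoeff R S L J A n C [])
  | n + 1, C, x :: ψ => gapGenerator R S L J C (x :: ψ) (dysonCoeff R S L J A n C (x :: ψ)) +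
      L x (dysonCoeff R S L J A n (x :: C) ψ)

/-- The product of the operators of the letters of a word, applied to `A`. -/
noncomputable def applyWord (L : F → E →L[ℝ] E) (J : F → ℝ) (A : E) (w : List F) : E :=
  w.foldr (fun x e => J x • L x e) A

variable {R : CausalVertex F → CausalVertex F → Bool} {S : Finset F} {L : F → E →L[ℝ] E}
  {J : F → ℝ} {A : E}

theorem norm_gapGenerator_le (C ψ : List F) :
    ‖gapGenerator R S L J C ψ‖ ≤ ∑ y, |J y| * ‖L y‖ := by
  refine norm_sum_le_of_le _ fun y _ => ?_
  split_ifs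
  · rw [norm_smul, Real.norm_eq_abs]
  · rw [norm_zero]; positivity

theorem norm_dysonCoeff_le (n : ℕ) (C ψ : List F) :
    ‖dysonCoeff R S L J A n C ψ‖ ≤ ‖A‖ * (∑ y, (|J y| + 1) * ‖L y‖) ^ n := by
  set K := ∑ y, (|J y| + 1) * ‖L y‖
  have hK : 0 ≤ K := Finset.sum_nonneg fun y _ => by positivity
  have hK' : K = ∑ y, |J y| * ‖L y‖ + ∑ y, ‖L y‖ := by
    rw [← Finset.sum_add_distrib]
    exact Finset.sum_congr rfl fun y _ => by ring
  have h2 : 0 ≤ ∑ y, ‖L y‖ := Finset.sum_nonneg fun y _ => norm_nonneg _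
  induction n generalizing C ψ with
  | zero => cases ψ <;> simp [dysonCoeff]
  | succ n ih =>
    have hg : ∀ ψ', ‖gapGenerator R S L J C ψ (dysonCoeff R S L J A n C ψ')‖ ≤
        (∑ y, |J y| * ‖L y‖) * (‖A‖ * K ^ n) := fun ψ' =>
      ContinuousLinearMap.le_of_opNorm_le_of_le _ (norm_gapGenerator_le C ψ) (ih C ψ')
    cases ψ with
    | nil =>
      rw [dysonCoeff]
      calc _ ≤ (∑ y, |J y| * ‖L y‖) * (‖A‖ * K ^ n) := hg []
        _ ≤ K * (‖A‖ * K ^ n) := by gcongr; linarith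
        _ = _ := by ring
    | cons x ψ =>
      rw [dysonCoeff]
      have hx : ‖L x‖ ≤ ∑ y, ‖L y‖ :=
        Finset.single_le_sum (fun y _ => norm_nonneg (L y)) (Finset.mem_univ x)
      calc _ ≤ (∑ y, |J y| * ‖L y‖) * (‖A‖ * K ^ n) + (∑ y, ‖L y‖) * (‖A‖ * K ^ n) :=
            norm_add_le_of_le (hg _) (ContinuousLinearMap.le_of_opNorm_le_of_le _ hx (ih _ _))
        _ = K * (‖A‖ * K ^ n) := by rw [hK']; ring
        _ = _ := by ring

/-- The sum of `t ^ |w| / |w|!` times the operator product of `w`, over all words `w` that arise from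
`ψ` by filling gaps. -/
noncomputable def dyson (R : CausalVertex F → CausalVertex F → Bool) (S : Finset F)
    (L : F → E →L[ℝ] E) (J : F → ℝ) (A : E) (C ψ : List F) (t : ℝ) : E :=
  expGen (fun n => dysonCoeff R S L J A n C ψ) t

open scoped InnerProductSpace

theorem inner_gapGenerator (hL : ∀ x e, ⟪L x e, e⟫_ℝ = 0) (C ψ : List F) (e : E) :
    ⟪gapGenerator R S L J C ψ e, e⟫_ℝ = 0 := by
  rw [gapGenerator, sum_apply, sum_inner]
  refine Finset.sum_eq_zero fun y _ => ?_
  split_ifs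
  · rw [smul_apply, real_inner_smul_left, hL, mul_zero]
  · simp

variable [CompleteSpace E]

theorem hasSum_dyson (C ψ : List F) (t : ℝ) :
    HasSum (fun n => (t ^ n / (n ! : ℝ)) • dysonCoeff R S L J A n C ψ) (dyson R S L J A C ψ t) :=
  hasSum_expGen (fun n => norm_dysonCoeff_le n C ψ) t

theorem hasSum_dysonCoeff_succ (C ψ : List F) (t : ℝ) :
    HasSum (fun n => (t ^ n / (n ! : ℝ)) • dysonCoeff R S L J A (n + 1) C ψ)
      (expGen (fun n => dysonCoeff R S L J A (n + 1) C ψ) t) :=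
  hasSum_expGen (M := ‖A‖ * ∑ y, (|J y| + 1) * ‖L y‖) (K := ∑ y, (|J y| + 1) * ‖L y‖)
    (fun n => (norm_dysonCoeff_le (n + 1) C ψ).trans_eq (by ring)) t

theorem hasDerivAt_dyson_nil (C : List F) (t : ℝ) :
    HasDerivAt (dyson R S L J A C [])
      (gapGenerator R S L J C [] (dyson R S L J A C [] t)) t := by
  refine (hasDerivAt_expGen (fun n => norm_dysonCoeff_le n C []) t).congr_deriv ?_
  refine (hasSum_dysonCoeff_succ C [] t).unique ?_
  have h := (gapGenerator R S L J C []).hasSum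
    (hasSum_dyson (R := R) (S := S) (L := L) (J := J) (A := A) C [] t)
  simpa only [map_smul, dysonCoeff] using h

theorem hasDerivAt_dyson_cons (C : List F) (x : F) (ψ : List F) (t : ℝ) :
    HasDerivAt (dyson R S L J A C (x :: ψ))
      (gapGenerator R S L J C (x :: ψ) (dyson R S L J A C (x :: ψ) t) +
        L x (dyson R S L J A (x :: C) ψ t)) t := by
  refine (hasDerivAt_expGen (fun n => norm_dysonCoeff_le n C (x :: ψ)) t).congr_deriv ?_
  refine (hasSum_dysonCoeff_succ C (x :: ψ) t).unique ?_
  have h := ((gapGenerator R S L J C (x :: ψ)).hasSum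
    (hasSum_dyson (R := R) (S := S) (L := L) (J := J) (A := A) C (x :: ψ) t)).add
    ((L x).hasSum
      (hasSum_dyson (R := R) (S := S) (L := L) (J := J) (A := A) (x :: C) ψ t))
  simpa only [map_smul, dysonCoeff, smul_add] using h

/-- The evolutions in the gaps preserve the norm, so that only the marked letters and the volume of
the simplex of their times enter. -/
theorem norm_dyson_le (hL : ∀ x e, ⟪L x e, e⟫_ℝ = 0) {ℓ : F → ℝ} (hℓ : ∀ x, ‖L x‖ ≤ ℓ x)
    (C ψ : List F) (t : ℝ) :
    ‖dyson R S L J A C ψ t‖ ≤ (ψ.map ℓ).prod * ‖A‖ * (|t| ^ ψ.length / (ψ.length ! : ℝ)) := by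
  have hprod : ∀ ψ : List F, 0 ≤ (ψ.map ℓ).prod := fun ψ =>
    List.prod_nonneg fun z hz => by
      obtain ⟨x, -, rfl⟩ := List.mem_map.1 hz
      exact (norm_nonneg _).trans (hℓ x)
  induction ψ generalizing C t with
  | nil =>
    have := norm_le_of_skew_of_const (inner_gapGenerator (R := R) (S := S) (J := J) hL C [])
      (fun s => hasDerivAt_dyson_nil (A := A) C s) t
    have h0 : dyson R S L J A C [] 0 = A := by rw [dyson, expGen_zero, dysonCoeff]
    simpa [h0] using this
  | cons x ψ ih =>
    refine norm_le_of_skew (inner_gapGenerator hL C (x :: ψ))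
      (fun s => hasDerivAt_dyson_cons C x ψ s) ?_
      (mul_nonneg (hprod _) (norm_nonneg _)) (fun s => ?_) t
    · rw [dyson, expGen_zero, dysonCoeff]
    · refine (ContinuousLinearMap.le_of_opNorm_le_of_le _ (hℓ x) (ih (x :: C) s)).trans_eq ?_
      rw [List.map_cons, List.prod_cons]
      ring

end Dyson

end OperatorGrowth

/-! ### Resummation over reduced words -/

namespace OperatorGrowth

section Resummation

variable {F : Type*} [Fintype F] {E : Type*} [NormedAddCommGroup E] [InnerProductSpace ℝ E]
  {R : CausalVertex F → CausalVertex F → Bool} {S : Finset F} {L : F → E →L[ℝ] E}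
  {J : F → ℝ} {A : E}

theorem apply_sumWords {G : Type*} [AddCommMonoid G] [Module ℝ G] (T : E →ₗ[ℝ] G) (n : ℕ)
    (g : List F → E) : T (sumWords n g) = sumWords n fun w => T (g w) :=
  map_sumWords T.toAddMonoidHom n g

/-- The Dyson coefficients enumerate the words that arise from `ψ` by filling gaps. -/
theorem prod_smul_dysonCoeff (n : ℕ) (C ψ : List F) :
    (ψ.map J).prod • dysonCoeff R S L J A n C ψ =
      sumWords n fun v => (fillings R S C ψ v : ℝ) • applyWord L J A v := by
  classical
  induction n generalizing C ψ with
  | zero => cases ψ <;> simp [dysonCoeff, sumWords, fillings, applyWord]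
  | succ n ih =>
    have happly : ∀ y w, applyWord L J A (y :: w) = (J y • L y) (applyWord L J A w) :=
      fun y w => rfl
    have hgap : ∀ ψ, gapGenerator R S L J C ψ ((ψ.map J).prod • dysonCoeff R S L J A n C ψ) =
        ∑ y, sumWords n fun w => (if GapAllowed R S C ψ y then (fillings R S C ψ w : ℝ) else 0) •
          applyWord L J A (y :: w) := by
      intro ψ
      rw [ih, gapGenerator, sum_apply]
      refine Finset.sum_congr rfl fun y _ => ?_
      split_ifs with h
      · refine (apply_sumWords (J y • L y).toLinearMap n _).trans ?_
        simp only [happly, ContinuousLinearMap.coe_coe, map_smul]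
      · simp [sumWords_zero]
    cases ψ with
    | nil =>
      rw [dysonCoeff, ← map_smul, hgap, sumWords]
      refine Finset.sum_congr rfl fun y _ => ?_
      congr 1
      funext w
      simp only [fillings, Nat.cast_ite, Nat.cast_zero]
    | cons x ψ =>
      rw [dysonCoeff, smul_add, ← map_smul, hgap, sumWords]
      have hx : ((x :: ψ).map J).prod • L x (dysonCoeff R S L J A n (x :: C) ψ) =
          ∑ y, sumWords n fun w => (if x = y then (fillings R S (x :: C) ψ w : ℝ) else 0) •
            applyWord L J A (y :: w) := by
        rw [Finset.sum_eq_single x]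
        · simp only [if_true]
          have := apply_sumWords (J x • L x).toLinearMap n fun w =>
            (fillings R S (x :: C) ψ w : ℝ) • applyWord L J A w
          rw [← ih] at this
          simp only [happly, ← map_smul]
          refine Eq.trans ?_ this
          simp only [List.map_cons, List.prod_cons, ContinuousLinearMap.coe_coe, smul_apply,
            map_smul, smul_smul, mul_comm (J x)]
        · intro y _ hy
          simp [hy.symm, sumWords_zero]
        · simp
      rw [hx, ← Finset.sum_add_distrib]
      refine Finset.sum_congr rfl fun y _ => ?_
      rw [← sumWords_add]
      congr 1
      funext w
      simp only [fillings, Nat.cast_add, Nat.cast_ite, Nat.cast_zero, add_smul]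

theorem sum_pow_apply (n : ℕ) :
    ((∑ y, J y • L y) ^ n) A = sumWords n (applyWord L J A) := by
  induction n with
  | zero => rfl
  | succ n ih =>
    rw [pow_succ', mul_apply_eq_comp, ih, sumWords, sum_apply]
    exact Finset.sum_congr rfl fun y _ => apply_sumWords (J y • L y).toLinearMap n _

theorem apply_sumWords₂ (β : E →L[ℝ] E →L[ℝ] ℝ) (n m : ℕ) (f g : List F → E) :
    β (sumWords n f) (sumWords m g) = sumWords n fun u => sumWords m fun v => β (f u) (g v) := by
  have h := apply_sumWords (β.flip (sumWords m g)).toLinearMap n f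
  simp only [ContinuousLinearMap.coe_coe, ContinuousLinearMap.flip_apply] at h
  rw [h]
  congr 1
  funext u
  exact apply_sumWords (β (f u)).toLinearMap m g

variable [DecidableEq F]

theorem finite_reduced (R : CausalVertex F → CausalVertex F → Bool) :
    {ψ : List F × List F | IsReduced R ψ}.Finite := by
  refine ((List.finite_length_le F (2 * Fintype.card F)).prod
    (List.finite_length_le F (2 * Fintype.card F))).subset fun ψ hψ => ?_
  have h : (ψ.1 ++ ψ.2).length ≤ 2 * Fintype.card F := by
    rw [← List.sum_toFinset_count_eq_length]
    calc _ ≤ ∑ x ∈ (ψ.1 ++ ψ.2).toFinset, 2 := Finset.sum_le_sum fun x _ => hψ.count_le x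
      _ ≤ _ := by
        rw [Finset.sum_const, smul_eq_mul, mul_comm]
        exact Nat.mul_le_mul_left _ (Finset.card_le_univ _)
  rw [List.length_append] at h
  exact ⟨by simp only [Set.mem_ofPred_eq]; omega, by simp only [Set.mem_ofPred_eq]; omega⟩

/-- The set of all reduced two-sided words. -/
noncomputable def reducedWords (R : CausalVertex F → CausalVertex F → Bool) :
    Finset (List F × List F) :=
  (finite_reduced R).toFinset

theorem mem_reducedWords {ψ : List F × List F} : ψ ∈ reducedWords R ↔ IsReduced R ψ := by
  simp [reducedWords]

/-- The words that contribute to a bilinear expression are sorted by the reduced words from which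
they arise. -/
theorem apply_sumWords_eq_sum_reduced (hR : R .root .root = true) (β : E →L[ℝ] E →L[ℝ] ℝ)
    (hz : ∀ u v, β (applyWord L J A u) (applyWord L J A v) ≠ 0 →
      Creeps R (outwardWord u v) ∧ Creeps R (outwardWord v u)) (n m : ℕ) :
    β (sumWords n (applyWord L J A)) (sumWords m (applyWord L J A)) =
      ∑ ψ ∈ reducedWords R, ((ψ.1 ++ ψ.2).map J).prod *
        β (dysonCoeff R (ψ.1 ++ ψ.2).toFinset L J A n ψ.2 ψ.1)
          (dysonCoeff R (ψ.1 ++ ψ.2).toFinset L J A m ψ.1 ψ.2) := by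
  have hterm : ∀ ψ : List F × List F, ((ψ.1 ++ ψ.2).map J).prod *
        β (dysonCoeff R (ψ.1 ++ ψ.2).toFinset L J A n ψ.2 ψ.1)
          (dysonCoeff R (ψ.1 ++ ψ.2).toFinset L J A m ψ.1 ψ.2) =
      sumWords n fun u => sumWords m fun v =>
        (multiplicity R ψ u v : ℝ) * β (applyWord L J A u) (applyWord L J A v) := by
    intro ψ
    calc _ = β ((ψ.1.map J).prod • dysonCoeff R (ψ.1 ++ ψ.2).toFinset L J A n ψ.2 ψ.1)
          ((ψ.2.map J).prod • dysonCoeff R (ψ.1 ++ ψ.2).toFinset L J A m ψ.1 ψ.2) := by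
          rw [map_smul, map_smul, smul_apply, smul_eq_mul, smul_eq_mul, List.map_append,
            List.prod_append]
          ring
      _ = _ := by
          rw [prod_smul_dysonCoeff, prod_smul_dysonCoeff, apply_sumWords₂]
          congr 1
          funext u
          congr 1
          funext v
          rw [map_smul, map_smul, smul_apply, smul_eq_mul, smul_eq_mul, multiplicity, Nat.cast_mul]
          ring
  simp only [hterm]
  rw [apply_sumWords₂, ← sumWords_sum]
  congr 1
  funext u
  rw [← sumWords_sum]
  congr 1
  funext v
  rw [← Finset.sum_mul]
  by_cases h0 : β (applyWord L J A u) (applyWord L J A v) = 0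
  · rw [h0, mul_zero]
  · obtain ⟨ψ, hψ, h1, h2⟩ := exists_isReduced hR (hz u v h0).1 (hz u v h0).2
    rw [Finset.sum_eq_single ψ (fun χ hχ hne => by
        rw [h2 χ (mem_reducedWords.1 hχ) hne, Nat.cast_zero])
      (fun h => absurd (mem_reducedWords.2 hψ) h), h1, Nat.cast_one, one_mul]

theorem bilin_eq_sum_of_hasSum (β : E →L[ℝ] E →L[ℝ] ℝ) {ι : Type*} (s : Finset ι) {c : ℕ → ℝ}
    {a : ℕ → E} {x : E} {k : ι → ℝ} {p q : ι → ℕ → E} {y z : ι → E}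
    (ha : HasSum (fun n => c n • a n) x) (hp : ∀ i ∈ s, HasSum (fun n => c n • p i n) (y i))
    (hq : ∀ i ∈ s, HasSum (fun n => c n • q i n) (z i))
    (h : ∀ n m, β (a n) (a m) = ∑ i ∈ s, k i * β (p i n) (q i m)) :
    β x x = ∑ i ∈ s, k i * β (y i) (z i) := by
  have h1 : ∀ n, β (a n) x = ∑ i ∈ s, k i * β (p i n) (z i) := by
    intro n
    refine ((β (a n)).hasSum ha).unique ?_
    refine (hasSum_sum fun i hi => ((β (p i n)).hasSum (hq i hi)).mul_left (k i)).congr_fun ?_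
    intro m
    simp only [map_smul, smul_eq_mul, h, Finset.mul_sum]
    exact Finset.sum_congr rfl fun i _ => by ring
  refine ((β.flip x).hasSum ha).unique ?_
  refine (hasSum_sum fun i hi => ((β.flip (z i)).hasSum (hp i hi)).mul_left (k i)).congr_fun ?_
  intro n
  simp only [map_smul, smul_eq_mul, ContinuousLinearMap.flip_apply, h1, Finset.mul_sum]
  exact Finset.sum_congr rfl fun i _ => by ring

variable [CompleteSpace E]

/-- The contribution of a reduced word `ψ` to a bilinear expression in the evolved vector, without
the couplings of the letters of `ψ`. -/
noncomputable def contribution (R : CausalVertex F → CausalVertex F → Bool) (L : F → E →L[ℝ] E)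
    (A : E) (β : E →L[ℝ] E →L[ℝ] ℝ) (t : ℝ) (ψ : List F × List F) (J : F → ℝ) : ℝ :=
  β (dyson R (ψ.1 ++ ψ.2).toFinset L J A ψ.2 ψ.1 t) (dyson R (ψ.1 ++ ψ.2).toFinset L J A ψ.1 ψ.2 t)

theorem bilin_evolved_eq_sum (hR : R .root .root = true) (β : E →L[ℝ] E →L[ℝ] ℝ)
    (hz : ∀ u v, β (applyWord L J A u) (applyWord L J A v) ≠ 0 →
      Creeps R (outwardWord u v) ∧ Creeps R (outwardWord v u)) {t : ℝ} {x : E}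
    (hx : HasSum (fun n => (t ^ n / (n ! : ℝ)) • ((∑ y, J y • L y) ^ n) A) x) :
    β x x = ∑ ψ ∈ reducedWords R, ((ψ.1 ++ ψ.2).map J).prod * contribution R L A β t ψ J := by
  simp only [sum_pow_apply] at hx
  exact bilin_eq_sum_of_hasSum β _ hx (fun ψ _ => hasSum_dyson ψ.2 ψ.1 t)
    (fun ψ _ => hasSum_dyson ψ.1 ψ.2 t) (apply_sumWords_eq_sum_reduced hR β hz)

end Resummation

end OperatorGrowth

/-! ### Averaging over the couplings -/

namespace OperatorGrowth

section Averaging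

variable {F : Type*} [Fintype F] {E : Type*} [NormedAddCommGroup E] [InnerProductSpace ℝ E]
  {R : CausalVertex F → CausalVertex F → Bool} {S : Finset F} {L : F → E →L[ℝ] E}
  {J : F → ℝ} {A : E}

theorem continuous_gapGenerator (C ψ : List F) :
    Continuous fun J => gapGenerator R S L J C ψ := by
  classical
  refine continuous_finsetSum _ fun y _ => ?_
  split_ifs <;> fun_prop

theorem continuous_dysonCoeff (n : ℕ) (C ψ : List F) :
    Continuous fun J => dysonCoeff R S L J A n C ψ := by
  induction n generalizing C ψ with
  | zero => cases ψ <;> simp only [dysonCoeff] <;> fun_prop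
  | succ n ih =>
    cases ψ with
    | nil => exact (continuous_gapGenerator C []).clm_apply (ih C [])
    | cons x ψ =>
      exact ((continuous_gapGenerator C (x :: ψ)).clm_apply (ih C (x :: ψ))).add
        ((L x).continuous.comp (ih (x :: C) ψ))

section

variable [DecidableEq F]

/-- A letter that is marked only once is allowed in no gap, so that its coupling does not enter. -/
theorem gapGenerator_congr {J J' : F → ℝ} {x : F} (hx : x ∈ S) (hJ : ∀ y, y ≠ x → J y = J' y)
    {C ψ : List F} (hc : (C ++ ψ).count x ≤ 1) :
    gapGenerator R S L J C ψ = gapGenerator R S L J' C ψ := by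
  refine Finset.sum_congr rfl fun y _ => ?_
  split_ifs with h
  · rw [hJ y]
    rintro rfl
    have h1 := List.count_pos_iff.2 (h.1 hx).1
    have h2 := List.count_pos_iff.2 (h.1 hx).2
    rw [List.count_append] at hc
    omega
  · rfl

theorem dysonCoeff_congr {J J' : F → ℝ} {x : F} (hx : x ∈ S) (hJ : ∀ y, y ≠ x → J y = J' y)
    (n : ℕ) {C ψ : List F} (hc : (C ++ ψ).count x ≤ 1) :
    dysonCoeff R S L J A n C ψ = dysonCoeff R S L J' A n C ψ := by
  induction n generalizing C ψ with
  | zero => cases ψ <;> rfl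
  | succ n ih =>
    cases ψ with
    | nil => rw [dysonCoeff, dysonCoeff, ih hc, gapGenerator_congr hx hJ hc]
    | cons z ψ =>
      rw [dysonCoeff, dysonCoeff, ih hc, gapGenerator_congr hx hJ hc, ih]
      simp only [List.count_append, List.count_cons] at hc ⊢
      omega

theorem contribution_congr {J J' : F → ℝ} {x : F} (hJ : ∀ y, y ≠ x → J y = J' y)
    {β : E →L[ℝ] E →L[ℝ] ℝ} {t : ℝ} {ψ : List F × List F} (hc : (ψ.1 ++ ψ.2).count x = 1) :
    contribution R L A β t ψ J = contribution R L A β t ψ J' := by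
  have hx : x ∈ (ψ.1 ++ ψ.2).toFinset :=
    List.mem_toFinset.2 (List.count_pos_iff.1 (by omega))
  have hc' : (ψ.2 ++ ψ.1).count x ≤ 1 := by
    rw [List.count_append] at hc ⊢
    omega
  simp only [contribution, dyson, dysonCoeff_congr hx hJ _ hc', dysonCoeff_congr hx hJ _ hc.le]

variable [CompleteSpace E]

omit [DecidableEq F] in
theorem stronglyMeasurable_dyson (C ψ : List F) (t : ℝ) :
    StronglyMeasurable fun J => dyson R S L J A C ψ t := by
  refine stronglyMeasurable_of_tendsto Filter.atTop
    (f := fun n J => ∑ k ∈ Finset.range n, (t ^ k / (k ! : ℝ)) • dysonCoeff R S L J A k C ψ)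
    (fun n => ?_) (tendsto_pi_nhds.2 fun J => (hasSum_dyson C ψ t).tendsto_sum_nat)
  exact (continuous_finsetSum _ fun k _ =>
    (continuous_dysonCoeff k C ψ).const_smul _).stronglyMeasurable

theorem stronglyMeasurable_contribution (β : E →L[ℝ] E →L[ℝ] ℝ) (t : ℝ) (ψ : List F × List F) :
    StronglyMeasurable (contribution R L A β t ψ) :=
  Continuous.comp_stronglyMeasurable (g := fun p : E × E => β p.1 p.2) (by fun_prop)
    ((stronglyMeasurable_dyson _ _ t).prodMk (stronglyMeasurable_dyson _ _ t))

open scoped InnerProductSpace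

theorem abs_contribution_le (hL : ∀ x e, ⟪L x e, e⟫_ℝ = 0) {ℓ : F → ℝ} (hℓ : ∀ x, ‖L x‖ ≤ ℓ x)
    {β : E →L[ℝ] E →L[ℝ] ℝ} (hβ : ∀ x y, |β x y| ≤ ‖x‖ * ‖y‖) (t : ℝ) (ψ : List F × List F)
    (J : F → ℝ) :
    |contribution R L A β t ψ J| ≤ ((ψ.1 ++ ψ.2).map ℓ).prod * ‖A‖ ^ 2 *
      (|t| ^ (ψ.1 ++ ψ.2).length / ((ψ.2.length ! : ℝ) * (ψ.1.length ! : ℝ))) := by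
  have h1 := norm_dyson_le (R := R) (S := (ψ.1 ++ ψ.2).toFinset) (J := J) (A := A) hL hℓ ψ.2 ψ.1 t
  have h2 := norm_dyson_le (R := R) (S := (ψ.1 ++ ψ.2).toFinset) (J := J) (A := A) hL hℓ ψ.1 ψ.2 t
  refine (hβ _ _).trans ((mul_le_mul h1 h2 (norm_nonneg _) ((norm_nonneg _).trans h1)).trans_eq ?_)
  rw [List.map_append, List.prod_append, List.length_append, pow_add]
  field_simp

end

section Probability

variable {μ : F → Measure ℝ} [∀ X, IsProbabilityMeasure (μ X)]

theorem integrable_prod_pow (hL2 : ∀ X, MemLp (fun x : ℝ => x) 2 (μ X)) {c : F → ℕ}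
    (hc : ∀ X, c X ≤ 2) : Integrable (fun J : F → ℝ => ∏ X, J X ^ c X) (Measure.pi μ) := by
  refine Integrable.fintype_prod (f := fun X x => x ^ c X) fun X => ?_
  have := hc X
  obtain h | h | h : c X = 0 ∨ c X = 1 ∨ c X = 2 := by omega
  · simp only [h, pow_zero]
    exact integrable_const 1
  · simp only [h, pow_one]
    exact (hL2 X).integrable one_le_two
  · simp only [h]
    exact (hL2 X).integrable_sq

/-- The average vanishes if a centred variable enters as a mere factor. -/
theorem integral_mul_eq_zero [DecidableEq F] (hmean : ∀ X, ∫ x, x ∂(μ X) = 0) {g : (F → ℝ) → ℝ}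
    (hg : StronglyMeasurable g) {X : F} (hX : ∀ J J' : F → ℝ, (∀ y, y ≠ X → J y = J' y) → g J = g J') :
    ∫ J, J X * g J ∂(Measure.pi μ) = 0 := by
  have hind : ProbabilityTheory.iIndepFun (fun (Y : F) (J : F → ℝ) => J Y) (Measure.pi μ) :=
    ProbabilityTheory.iIndepFun_pi (X := fun _ x => x) fun _ => aemeasurable_id
  set T : Finset F := Finset.univ.erase X with hT
  have h2 := hind.indepFun_finset {X} T (by simp [hT]) (fun Y => measurable_pi_apply Y)
  -- `g` as a function of the remaining couplings
  let e : (T → ℝ) → F → ℝ := fun z Y => if h : Y ∈ T then z ⟨Y, h⟩ else 0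
  have he : Measurable e := measurable_pi_iff.2 fun Y => by
    by_cases h : Y ∈ T
    · simp only [e, h, dif_pos]
      exact measurable_pi_apply _
    · simp only [e, h, dif_neg, not_false_eq_true]
      exact measurable_const
  have h3 := h2.comp
    (show Measurable fun z : ({X} : Finset F) → ℝ => z ⟨X, by simp⟩ from measurable_pi_apply _)
    (hg.measurable.comp he)
  have hge : ((g ∘ e) ∘ fun (J : F → ℝ) (Y : T) => J Y) = g := by
    funext J
    refine hX _ _ fun y hy => ?_
    simp [e, hT, hy]
  rw [hge] at h3
  have h4 := h3.integral_fun_mul_eq_mul_integral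
    (measurable_pi_apply X).aestronglyMeasurable hg.aestronglyMeasurable
  refine h4.trans ?_
  simp only [Function.comp_apply]
  rw [integral_eval, hmean, zero_mul]

variable [DecidableEq F]

theorem list_prod_eq_prod_pow (l : List F) (J : F → ℝ) :
    (l.map J).prod = ∏ X, J X ^ l.count X := by
  rw [Finset.prod_list_map_count]
  refine Finset.prod_subset (Finset.subset_univ _) fun x _ hx => ?_
  rw [List.count_eq_zero.2 fun h => hx (List.mem_toFinset.2 h), pow_zero]

omit [Fintype F] in
theorem list_prod_eq_prod_sq {l : List F} (hl : ∀ x ∈ l, l.count x = 2) (g : F → ℝ) :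
    (l.map g).prod = ∏ X ∈ l.toFinset, g X ^ 2 := by
  rw [Finset.prod_list_map_count]
  exact Finset.prod_congr rfl fun x hx => by rw [hl x (List.mem_toFinset.1 hx)]

variable [CompleteSpace E]

open scoped InnerProductSpace

theorem integrable_prod_mul_contribution (hL2 : ∀ X, MemLp (fun x : ℝ => x) 2 (μ X))
    (hL : ∀ x e, ⟪L x e, e⟫_ℝ = 0)
    {β : E →L[ℝ] E →L[ℝ] ℝ} (hβ : ∀ x y, |β x y| ≤ ‖x‖ * ‖y‖) (t : ℝ) {ψ : List F × List F}
    (hψ : IsReduced R ψ) :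
    Integrable (fun J : F → ℝ => ((ψ.1 ++ ψ.2).map J).prod * contribution R L A β t ψ J)
      (Measure.pi μ) := by
  simp only [list_prod_eq_prod_pow]
  refine (integrable_prod_pow hL2 hψ.count_le).mul_bdd
    (stronglyMeasurable_contribution β t ψ).aestronglyMeasurable
    (Filter.Eventually.of_forall fun J => abs_contribution_le hL (fun x => le_rfl) hβ t ψ J)

/-- Reduced words with a letter that occurs only once do not contribute to the average. -/
theorem integral_prod_mul_contribution_eq_zero (hmean : ∀ X, ∫ x, x ∂(μ X) = 0)
    {β : E →L[ℝ] E →L[ℝ] ℝ} (t : ℝ) {ψ : List F × List F} {X : F}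
    (hX : (ψ.1 ++ ψ.2).count X = 1) :
    ∫ J : F → ℝ, ((ψ.1 ++ ψ.2).map J).prod * contribution R L A β t ψ J ∂(Measure.pi μ) = 0 := by
  have hsplit : ∀ J : F → ℝ, ((ψ.1 ++ ψ.2).map J).prod * contribution R L A β t ψ J =
      J X * ((∏ Y ∈ Finset.univ.erase X, J Y ^ (ψ.1 ++ ψ.2).count Y) *
        contribution R L A β t ψ J) := fun J => by
    rw [list_prod_eq_prod_pow, ← Finset.mul_prod_erase _ _ (Finset.mem_univ X), hX, pow_one,
      mul_assoc]
  simp only [hsplit]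
  refine integral_mul_eq_zero hmean ?_ fun J J' h => ?_
  · exact (Continuous.stronglyMeasurable (by fun_prop)).mul (stronglyMeasurable_contribution β t ψ)
  · rw [contribution_congr h hX, Finset.prod_congr rfl fun Y hY => by
      rw [h Y (Finset.ne_of_mem_erase hY)]]

theorem integral_prod_mul_contribution_le (hL2 : ∀ X, MemLp (fun x : ℝ => x) 2 (μ X))
    {𝒥 : F → ℝ} (hvar : ∀ X, ∫ x, x ^ 2 ∂(μ X) = 𝒥 X ^ 2) (hL : ∀ x e, ⟪L x e, e⟫_ℝ = 0)
    {h : F → ℝ} (hh : ∀ x, ‖L x‖ ≤ 2 * h x)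
    {β : E →L[ℝ] E →L[ℝ] ℝ} (hβ : ∀ x y, |β x y| ≤ ‖x‖ * ‖y‖) (t : ℝ) {ψ : List F × List F}
    (hψ : IsReduced R ψ) (h2 : ∀ x ∈ ψ.1 ++ ψ.2, (ψ.1 ++ ψ.2).count x = 2) :
    ∫ J : F → ℝ, ((ψ.1 ++ ψ.2).map J).prod * contribution R L A β t ψ J ∂(Measure.pi μ) ≤
      ‖A‖ ^ 2 * (1 / ((ψ.2.length ! : ℝ) * (ψ.1.length ! : ℝ)) *
        ∏ X ∈ (ψ.1 ++ ψ.2).toFinset, (2 * (𝒥 X * h X) * t) ^ 2) := by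
  set l := ψ.1 ++ ψ.2 with hl
  set B := (l.map fun x => 2 * h x).prod * ‖A‖ ^ 2 *
    (|t| ^ l.length / ((ψ.2.length ! : ℝ) * (ψ.1.length ! : ℝ))) with hB
  have hint : Integrable (fun J : F → ℝ => ∏ X, J X ^ l.count X) (Measure.pi μ) :=
    integrable_prod_pow hL2 hψ.count_le
  have hnn : ∀ J : F → ℝ, 0 ≤ ∏ X, J X ^ l.count X := fun J => by
    rw [← list_prod_eq_prod_pow, list_prod_eq_prod_sq h2]
    exact Finset.prod_nonneg fun X _ => sq_nonneg _
  have hprod : ∫ J : F → ℝ, ∏ X, J X ^ l.count X ∂(Measure.pi μ) = (l.map 𝒥).prod := by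
    rw [integral_fintype_prod_eq_prod (f := fun X x => x ^ l.count X), list_prod_eq_prod_pow]
    refine Finset.prod_congr rfl fun X _ => ?_
    by_cases hX : X ∈ l
    · rw [h2 X hX, hvar]
    · rw [List.count_eq_zero.2 hX]
      simp
  have hpow : |t| ^ l.length = (l.map fun _ => |t|).prod := by simp
  calc ∫ J : F → ℝ, (l.map J).prod * contribution R L A β t ψ J ∂(Measure.pi μ)
      ≤ ∫ J : F → ℝ, (∏ X, J X ^ l.count X) * B ∂(Measure.pi μ) := by
        refine integral_mono (integrable_prod_mul_contribution hL2 hL hβ t hψ)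
          (hint.mul_const B) fun J => ?_
        simp only
        rw [list_prod_eq_prod_pow]
        exact mul_le_mul_of_nonneg_left
          ((le_abs_self _).trans (abs_contribution_le hL hh hβ t ψ J)) (hnn J)
    _ = (l.map 𝒥).prod * B := by rw [integral_mul_const, hprod]
    _ = _ := by
        rw [hB, hpow, list_prod_eq_prod_sq h2, list_prod_eq_prod_sq h2, list_prod_eq_prod_sq h2]
        have : ∏ X ∈ l.toFinset, (2 * (𝒥 X * h X) * t) ^ 2 =
            (∏ X ∈ l.toFinset, 𝒥 X ^ 2) * (∏ X ∈ l.toFinset, (2 * h X) ^ 2) *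
              ∏ X ∈ l.toFinset, |t| ^ 2 := by
          rw [← Finset.prod_mul_distrib, ← Finset.prod_mul_distrib]
          refine Finset.prod_congr rfl fun X _ => ?_
          rw [sq_abs]
          ring
        rw [this]
        ring

end Probability

end Averaging

section TreePairs

variable {V F : Type*} [DecidableEq V] [Fintype F] [DecidableEq F] {E : Type*}
  [NormedAddCommGroup E] [InnerProductSpace ℝ E] [CompleteSpace E]
  {L : F → E →L[ℝ] E} {A : E} {supp : F → Finset V} {i j : V}
  {μ : F → Measure ℝ} [∀ X, IsProbabilityMeasure (μ X)]

/-- The reduced words in which every letter occurs twice are among the orderings of the irreducible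
causal tree pairs. -/
theorem sum_reduced_le_treePairSum (hij : i ≠ j) (g : F → ℝ) (t : ℝ) :
    ∑ ψ ∈ reducedWords (touches supp i j) with ∀ x ∈ ψ.1 ++ ψ.2, (ψ.1 ++ ψ.2).count x = 2,
      1 / ((ψ.2.length ! : ℝ) * (ψ.1.length ! : ℝ)) *
        ∏ X ∈ (ψ.1 ++ ψ.2).toFinset, (2 * g X * t) ^ 2 ≤ treePairSum supp i j g t := by
  classical
  let M : List F × List F → TwoSided F := fun ψ => ⟨ψ.1.reverse, ψ.2⟩
  let f : (_ : CausalGraph F × CausalGraph F) × TwoSided F → ℝ := fun p =>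
    1 / ((p.2.left.length ! : ℝ) * (p.2.right.length ! : ℝ)) *
      ∏ X ∈ factorSet p.1.1 ∪ factorSet p.1.2, (2 * g X * t) ^ 2
  have hf : ∀ p, 0 ≤ f p := fun p =>
    mul_nonneg (by positivity) (Finset.prod_nonneg fun X _ => sq_nonneg _)
  let Φ : List F × List F → (_ : CausalGraph F × CausalGraph F) × TwoSided F := fun ψ =>
    ⟨treePair supp i j (M ψ), M ψ⟩
  have hΦ : Function.Injective Φ := by
    intro ψ χ h
    have hM : M ψ = M χ := congrArg (fun p => p.2) h
    simp only [M, TwoSided.mk.injEq, List.reverse_inj] at hM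
    exact Prod.ext hM.1 hM.2
  rw [treePairSum, Finset.sum_sigma']
  calc _ = ∑ ψ ∈ reducedWords (touches supp i j) with
        ∀ x ∈ ψ.1 ++ ψ.2, (ψ.1 ++ ψ.2).count x = 2, f (Φ ψ) := by
        refine Finset.sum_congr rfl fun ψ _ => ?_
        have hset : (ψ.1 ++ ψ.2).toFinset = factorSet (Φ ψ).1.1 ∪ factorSet (Φ ψ).1.2 := by
          ext x
          simp only [Φ, M, treePair, TwoSided.readLeft_eq, TwoSided.readRight_eq,
            List.reverse_reverse, Finset.mem_union, mem_factorSet_causalForest, List.mem_toFinset,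
            List.mem_append]
          tauto
        rw [hset]
        simp [f, Φ, M]
    _ = ∑ p ∈ Finset.image Φ {ψ ∈ reducedWords (touches supp i j) |
        ∀ x ∈ ψ.1 ++ ψ.2, (ψ.1 ++ ψ.2).count x = 2}, f p := by
        rw [Finset.sum_image fun _ _ _ _ h => hΦ h]
    _ ≤ _ := by
        refine Finset.sum_le_sum_of_subset_of_nonneg ?_ fun p _ _ => hf p
        intro p hp
        obtain ⟨ψ, hψ, rfl⟩ := Finset.mem_image.1 hp
        obtain ⟨hψ1, hψ2⟩ := Finset.mem_filter.1 hψ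
        have hr := mem_reducedWords.1 hψ1
        have hfac : ∀ x, (M ψ).factors.count x = (ψ.1 ++ ψ.2).count x := fun x => by
          simp [M, TwoSided.factors]
        have hord := IsReduced.mem_orderings (supp := supp) hij (M := M ψ)
          (by simpa [M] using hr) fun x hx => by
            rw [hfac]
            exact hψ2 x (by simpa [M, TwoSided.factors] using hx)
        simpa [Φ] using hord

open scoped InnerProductSpace

/-- The averaged bilinear bound: all generators are skew, and the words that contribute to the
bilinear form creep from both sides. -/
theorem integral_bilin_evolved_le (hij : i ≠ j) (hL2 : ∀ X, MemLp (fun x : ℝ => x) 2 (μ X))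
    (hmean : ∀ X, ∫ x, x ∂(μ X) = 0) {𝒥 : F → ℝ} (hvar : ∀ X, ∫ x, x ^ 2 ∂(μ X) = 𝒥 X ^ 2)
    (hL : ∀ x e, ⟪L x e, e⟫_ℝ = 0) {h : F → ℝ} (hh : ∀ x, ‖L x‖ ≤ 2 * h x)
    {β : E →L[ℝ] E →L[ℝ] ℝ} (hβ : ∀ x y, |β x y| ≤ ‖x‖ * ‖y‖)
    (hz : ∀ J u v, β (applyWord L J A u) (applyWord L J A v) ≠ 0 →
      Creeps (touches supp i j) (outwardWord u v) ∧ Creeps (touches supp i j) (outwardWord v u))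
    {t : ℝ} {f : (F → ℝ) → E}
    (hf : ∀ J, HasSum (fun n => (t ^ n / (n ! : ℝ)) • ((∑ y, J y • L y) ^ n) A) (f J)) :
    Integrable (fun J => β (f J) (f J)) (Measure.pi μ) ∧
      ∫ J, β (f J) (f J) ∂(Measure.pi μ) ≤
        ‖A‖ ^ 2 * treePairSum supp i j (fun X => 𝒥 X * h X) t := by
  have hR : touches supp i j (.root : CausalVertex F) .root = true := by simp [touches, nodes]
  have heq : (fun J => β (f J) (f J)) = fun J => ∑ ψ ∈ reducedWords (touches supp i j),
      ((ψ.1 ++ ψ.2).map J).prod * contribution (touches supp i j) L A β t ψ J :=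
    funext fun J => bilin_evolved_eq_sum hR β (hz J) (hf J)
  have hint : ∀ ψ ∈ reducedWords (touches supp i j), Integrable (fun J : F → ℝ =>
      ((ψ.1 ++ ψ.2).map J).prod * contribution (touches supp i j) L A β t ψ J) (Measure.pi μ) :=
    fun ψ hψ => integrable_prod_mul_contribution hL2 hL hβ t (mem_reducedWords.1 hψ)
  rw [heq]
  refine ⟨integrable_finsetSum _ hint, ?_⟩
  rw [integral_finsetSum _ hint]
  refine le_trans ?_ (mul_le_mul_of_nonneg_left (sum_reduced_le_treePairSum hij _ t)
    (sq_nonneg ‖A‖))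
  rw [Finset.mul_sum, Finset.sum_filter]
  refine Finset.sum_le_sum fun ψ hψ => ?_
  have hr := mem_reducedWords.1 hψ
  split_ifs with h2
  · exact integral_prod_mul_contribution_le hL2 hvar hL hh hβ t hr h2
  · push Not at h2
    obtain ⟨x, hx, hx2⟩ := h2
    have := List.count_pos_iff.2 hx
    have := hr.count_le x
    exact (integral_prod_mul_contribution_eq_zero hmean t (X := x) (by omega)).le

end TreePairs

end OperatorGrowth

/-! ### Supports of operators -/

namespace OperatorGrowth

section Supports

variable {V : Type*} [DecidableEq V] {d : V → ℕ}

/-- `O` acts trivially on the tensor factor at `v`, in terms of matrix entries. -/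
def ActsTrivially (v : V) (O : Op d) : Prop :=
  ∀ x y : Config d, (x v ≠ y v → O x y = 0) ∧
    (x v = y v → ∀ s, O (Function.update x v s) (Function.update y v s) = O x y)

theorem actsTrivially_trivialPart (v : V) (O : Op d) : ActsTrivially v (trivialPart v O) := by
  intro x y
  constructor
  · intro h
    simp [trivialPart, h]
  · intro h s
    simp [trivialPart, h]

theorem trivialPart_eq_self_iff (hd : ∀ v, 1 < d v) {v : V} {O : Op d} :
    trivialPart v O = O ↔ ActsTrivially v O := by
  constructor
  · intro h
    rw [← h]
    exact actsTrivially_trivialPart v O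
  · intro h
    ext x y
    by_cases hxy : x v = y v
    · have hd' : (d v : ℂ) ≠ 0 := by
        have := hd v
        exact_mod_cast (by omega : d v ≠ 0)
      simp [trivialPart, hxy, (h x y).2 hxy, hd']
    · simp [trivialPart, hxy, (h x y).1 hxy]

theorem proj_eq_zero_iff (hd : ∀ v, 1 < d v) {v : V} {O : Op d} :
    proj v O = 0 ↔ ActsTrivially v O := by
  rw [← trivialPart_eq_self_iff hd, proj, LinearMap.sub_apply, LinearMap.id_apply, sub_eq_zero,
    eq_comm]

theorem ActsTrivially.smul {v : V} {A : Op d} (c : ℂ) (hA : ActsTrivially v A) :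
    ActsTrivially v (c • A) := fun x y =>
  ⟨fun h => by simp [(hA x y).1 h], fun h s => by simp [(hA x y).2 h s]⟩

theorem ActsTrivially.sub {v : V} {A B : Op d} (hA : ActsTrivially v A) (hB : ActsTrivially v B) :
    ActsTrivially v (A - B) := fun x y =>
  ⟨fun h => by simp [(hA x y).1 h, (hB x y).1 h],
    fun h s => by simp [(hA x y).2 h s, (hB x y).2 h s]⟩

/-- Trivial action at `v` is preserved under taking the trivial part at another factor. -/
theorem ActsTrivially.trivialPart {v w : V} {A : Op d} (hA : ActsTrivially v A) :
    ActsTrivially v (trivialPart w A) := by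
  by_cases hvw : v = w
  · rw [hvw]
    exact actsTrivially_trivialPart w A
  intro x y
  constructor
  · intro h
    have : ∀ s : Fin (d w), A (Function.update x w s) (Function.update y w s) = 0 := fun s =>
      (hA _ _).1 (by rwa [Function.update_of_ne hvw, Function.update_of_ne hvw])
    simp [OperatorGrowth.trivialPart, this]
  · intro h s
    have : ∀ r : Fin (d w), A (Function.update (Function.update x v s) w r)
        (Function.update (Function.update y v s) w r) =
        A (Function.update x w r) (Function.update y w r) := fun r => by
      rw [Function.update_comm hvw, Function.update_comm hvw]
      exact (hA _ _).2 (by rwa [Function.update_of_ne hvw, Function.update_of_ne hvw]) s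
    simp [OperatorGrowth.trivialPart, this, Function.update_of_ne (Ne.symm hvw)]

/-- An operator that acts trivially at `v` is invariant under a permutation of the basis there. -/
theorem ActsTrivially.apply_permute {v : V} {A : Op d} (hA : ActsTrivially v A)
    (π : Equiv.Perm (Fin (d v))) (x y : Config d) :
    A (Function.update x v (π (x v))) (Function.update y v (π (y v))) = A x y := by
  by_cases h : x v = y v
  · rw [← h]
    exact (hA x y).2 h _
  · rw [(hA x y).1 h, (hA _ _).1]
    simpa using h

/-- `O` acts trivially outside `N`. -/
def SupportedOn (N : Finset V) (O : Op d) : Prop :=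
  ∀ v ∉ N, ActsTrivially v O

theorem SupportedOn.mono {N N' : Finset V} {O : Op d} (h : SupportedOn N O) (hN : N ⊆ N') :
    SupportedOn N' O := fun v hv => h v fun h' => hv (hN h')

theorem IsLocal.supportedOn (hd : ∀ v, 1 < d v) {N : Finset V} {O : Op d} (h : IsLocal N O) :
    SupportedOn N O := fun v hv => by
  rw [← proj_eq_zero_iff hd, h v, if_neg hv]

theorem SupportedOn.apply_eq_zero {N : Finset V} {O : Op d} (h : SupportedOn N O) {x y : Config d}
    {v : V} (hv : v ∉ N) (hxy : x v ≠ y v) : O x y = 0 :=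
  (h v hv x y).1 hxy

variable [Fintype V]

theorem ActsTrivially.mul {v : V} {A B : Op d} (hA : ActsTrivially v A) (hB : ActsTrivially v B) :
    ActsTrivially v (A * B) := by
  intro x y
  constructor
  · intro h
    rw [Matrix.mul_apply]
    refine Finset.sum_eq_zero fun z _ => ?_
    by_cases hz : x v = z v
    · rw [(hB z y).1 (hz ▸ h), mul_zero]
    · rw [(hA x z).1 hz, zero_mul]
  · intro h s
    -- The intermediate configurations are permuted at `v` along with the outer ones.
    let π : Equiv.Perm (Fin (d v)) := Equiv.swap (x v) s
    have hπ : s = π (x v) := (Equiv.swap_apply_left _ _).symm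
    let e : Equiv.Perm (Config d) := Function.Involutive.toPerm
      (fun z => Function.update z v (π (z v))) fun z => by simp [π]
    have hx : Function.update x v s = Function.update x v (π (x v)) := by rw [← hπ]
    have hy : Function.update y v s = Function.update y v (π (y v)) := by rw [← h, ← hπ]
    rw [Matrix.mul_apply, Matrix.mul_apply, ← Equiv.sum_comp e, hx, hy]
    refine Finset.sum_congr rfl fun z _ => ?_
    exact congrArg₂ (· * ·) (hA.apply_permute π x z) (hB.apply_permute π z y)

/-- The entries of an operator supported on `N` depend only on what happens on `N`, apart from
being zero off the diagonal elsewhere. -/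
theorem SupportedOn.apply_eq {N : Finset V} {O : Op d} (h : SupportedOn N O)
    {x y x' y' : Config d} (hx : ∀ v ∈ N, x v = x' v) (hy : ∀ v ∈ N, y v = y' v)
    (hxy : ∀ v ∉ N, x v = y v) (hxy' : ∀ v ∉ N, x' v = y' v) : O x y = O x' y' := by
  have key : ∀ M : Finset V, Disjoint M N →
      O (M.piecewise x' x) (M.piecewise x' y) = O x y := by
    intro M
    induction M using Finset.induction_on with
    | empty => simp
    | insert v M hv ih =>
      intro hM
      rw [Finset.disjoint_insert_left] at hM
      rw [Finset.piecewise_insert, Finset.piecewise_insert, ← ih hM.2]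
      refine (h v hM.1 _ _).2 ?_ _
      rw [Finset.piecewise_eq_of_notMem _ _ _ hv, Finset.piecewise_eq_of_notMem _ _ _ hv,
        hxy v hM.1]
  rw [← key (Finset.univ \ N) Finset.sdiff_disjoint]
  congr 1
  · funext v
    by_cases hv : v ∈ N <;> simp [hv, hx]
  · funext v
    by_cases hv : v ∈ N <;> simp [hv, hy, hxy']

/-- Operators with disjoint supports commute. -/
theorem SupportedOn.commute {N N' : Finset V} {A B : Op d} (hA : SupportedOn N A)
    (hB : SupportedOn N' B) (hN : Disjoint N N') : A * B = B * A := by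
  ext x y
  have hNN : ∀ v ∈ N, v ∉ N' := fun v hv hv' => Finset.disjoint_left.1 hN hv hv'
  -- Only one intermediate configuration contributes to either product.
  rw [Matrix.mul_apply, Matrix.mul_apply,
    Finset.sum_eq_single (N.piecewise y x) ?_ (by simp),
    Finset.sum_eq_single (N.piecewise x y) ?_ (by simp)]
  · have h1 : A x (N.piecewise y x) = A (N.piecewise x y) y := by
      refine hA.apply_eq ?_ ?_ ?_ ?_ <;> intro v hv <;> simp [hv]
    have h2 : B (N.piecewise y x) y = B x (N.piecewise x y) := by
      by_cases hxy : ∀ v, v ∉ N → v ∉ N' → x v = y v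
      · refine hB.apply_eq ?_ ?_ ?_ ?_ <;> intro v hv
        · have : v ∉ N := fun h => hNN v h hv
          simp [this]
        · have : v ∉ N := fun h => hNN v h hv
          simp [this]
        · by_cases hvN : v ∈ N
          · simp [hvN]
          · simp [hvN, hxy v hvN hv]
        · by_cases hvN : v ∈ N
          · simp [hvN]
          · simp [hvN, hxy v hvN hv]
      · push Not at hxy
        obtain ⟨v, hv, hv', hne⟩ := hxy
        rw [hB.apply_eq_zero hv' (by simpa [hv] using hne),
          hB.apply_eq_zero hv' (by simpa [hv] using hne)]
    rw [h1, h2, mul_comm]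
  · intro z _ hz
    by_contra h0
    obtain ⟨hb, ha⟩ := mul_ne_zero_iff.1 h0
    refine hz (funext fun v => ?_)
    by_cases hv : v ∈ N
    · rw [Finset.piecewise_eq_of_mem _ _ _ hv]
      by_contra h
      exact hb (hB.apply_eq_zero (hNN v hv) (Ne.symm h))
    · rw [Finset.piecewise_eq_of_notMem _ _ _ hv]
      by_contra h
      exact ha (hA.apply_eq_zero hv h)
  · intro z _ hz
    by_contra h0
    obtain ⟨ha, hb⟩ := mul_ne_zero_iff.1 h0
    refine hz (funext fun v => ?_)
    by_cases hv : v ∈ N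
    · rw [Finset.piecewise_eq_of_mem _ _ _ hv]
      by_contra h
      exact hb (hB.apply_eq_zero (hNN v hv) h)
    · rw [Finset.piecewise_eq_of_notMem _ _ _ hv]
      by_contra h
      exact ha (hA.apply_eq_zero hv (Ne.symm h))

theorem liouvillian_apply (H O : Op d) : liouvillian H O = Complex.I • (H * O - O * H) := rfl

theorem SupportedOn.liouvillian {N N' : Finset V} {H O : Op d} (hH : SupportedOn N H)
    (hO : SupportedOn N' O) : SupportedOn (N ∪ N') (liouvillian H O) := by
  intro v hv
  rw [Finset.mem_union, not_or] at hv
  rw [liouvillian_apply]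
  exact (((hH v hv.1).mul (hO v hv.2)).sub ((hO v hv.2).mul (hH v hv.1))).smul _

theorem liouvillian_eq_zero {N N' : Finset V} {H O : Op d} (hH : SupportedOn N H)
    (hO : SupportedOn N' O) (h : Disjoint N N') : OperatorGrowth.liouvillian H O = 0 := by
  rw [liouvillian_apply, hH.commute hO h, sub_self, smul_zero]

omit [Fintype V] in
theorem SupportedOn.proj {N : Finset V} {O : Op d} (hO : SupportedOn N O) (j : V) :
    SupportedOn N (proj j O) := fun v hv => by
  rw [OperatorGrowth.proj, LinearMap.sub_apply, LinearMap.id_apply]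
  exact (hO v hv).sub (hO v hv).trivialPart

end Supports

section Creeping

variable {V F : Type*} [DecidableEq V] {d : V → ℕ}
  {supp : F → Finset V} {H : F → Op d} {i j : V} {A : Op d}

/-- The nodes of the root and of the entries of a word. -/
def wordNodes (supp : F → Finset V) (i j : V) (w : List (CausalVertex F)) : Finset V :=
  w.foldr (fun c N => nodes supp i j c ∪ N) {i}

theorem mem_wordNodes {w : List (CausalVertex F)} {k : V} :
    k ∈ wordNodes supp i j w ↔ ∃ c ∈ CausalVertex.root :: w, k ∈ nodes supp i j c := by
  induction w with
  | nil => simp [wordNodes, nodes]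
  | cons a w ih =>
    rw [wordNodes, List.foldr_cons, Finset.mem_union, ← wordNodes, ih]
    simp only [List.mem_cons, exists_eq_or_imp]
    tauto

variable [Fintype V]

/-- The operator on operators that belongs to a vertex: the Liouvillian of a factor, or the
projection at the target. -/
noncomputable def vertexMap (H : F → Op d) (j : V) : CausalVertex F → Op d →ₗ[ℂ] Op d
  | .root => LinearMap.id
  | .factor X => liouvillian (H X)
  | .target => proj j

/-- The product of the operators of the vertices of a word, applied to `A`; the last entry acts
first. -/
noncomputable def vertexWord (H : F → Op d) (j : V) (A : Op d) (w : List (CausalVertex F)) : Op d :=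
  w.foldr (fun c O => vertexMap H j c O) A

theorem vertexWord_cons (c : CausalVertex F) (w : List (CausalVertex F)) :
    vertexWord H j A (c :: w) = vertexMap H j c (vertexWord H j A w) := rfl

theorem supportedOn_vertexWord (hH : ∀ X, SupportedOn (supp X) (H X)) (hA : SupportedOn {i} A)
    (w : List (CausalVertex F)) : SupportedOn (wordNodes supp i j w) (vertexWord H j A w) := by
  induction w with
  | nil => exact hA
  | cons c w ih =>
    rw [vertexWord_cons]
    cases c with
    | root => exact ih.mono Finset.subset_union_right
    | factor X => exact (hH X).liouvillian ih
    | target => exact (ih.proj j).mono Finset.subset_union_right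

/-- A word whose operator product does not annihilate an operator at the root creeps when read in
the order in which its operators act. -/
theorem creeps_reverse_of_vertexWord_ne_zero [DecidableEq F] (hd : ∀ v, 1 < d v)
    (hH : ∀ X, SupportedOn (supp X) (H X)) (hA : SupportedOn {i} A) {w : List (CausalVertex F)}
    (hw : .root ∉ w) (h : vertexWord H j A w ≠ 0) : Creeps (touches supp i j) w.reverse := by
  induction w with
  | nil => intro a ha; simp at ha
  | cons c w ih =>
    simp only [List.mem_cons, not_or] at hw
    rw [vertexWord_cons] at h
    have h0 : vertexWord H j A w ≠ 0 := fun h0 => h (by rw [h0, map_zero])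
    have hs := supportedOn_vertexWord (j := j) hH hA w
    have htouch : ∃ b ∈ CausalVertex.root :: w.reverse, touches supp i j b c = true := by
      have hne : (nodes supp i j c ∩ wordNodes supp i j w).Nonempty := by
        by_contra hemp
        rw [Finset.not_nonempty_iff_eq_empty, ← Finset.disjoint_iff_inter_eq_empty] at hemp
        cases c with
        | root => exact hw.1 rfl
        | factor X => exact h (liouvillian_eq_zero (hH X) hs hemp)
        | target =>
          exact h ((proj_eq_zero_iff hd).2 (hs j (by simpa [nodes] using hemp)))
      obtain ⟨k, hk⟩ := hne
      rw [Finset.mem_inter, mem_wordNodes] at hk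
      obtain ⟨hkc, b, hb, hkb⟩ := hk
      exact ⟨b, by simpa using hb, decide_eq_true ⟨k, Finset.mem_inter.2 ⟨hkb, hkc⟩⟩⟩
    have ih' := ih hw.2 h0
    have hext : ∀ {a b}, firstTouch (touches supp i j) (.root :: w.reverse) a = some b →
        firstTouch (touches supp i j) (.root :: (c :: w).reverse) a = some b := by
      intro a b hb
      rw [List.reverse_cons, ← List.cons_append, firstTouch_append, hb, Option.some_or]
    intro a ha
    by_cases haw : a ∈ w.reverse
    · obtain ⟨b, hb, hne⟩ := ih' a haw
      exact ⟨b, hext hb, hne⟩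
    · have hac : a = c := by
        rw [List.reverse_cons, List.mem_append, List.mem_singleton] at ha
        exact ha.resolve_left haw
      subst hac
      have hsome : (firstTouch (touches supp i j) (.root :: w.reverse) a).isSome := by
        rw [firstTouch, List.find?_isSome]
        exact htouch
      obtain ⟨b, hb⟩ := Option.isSome_iff_exists.1 hsome
      refine ⟨b, hext hb, ?_⟩
      rintro rfl
      have := List.mem_of_find?_eq_some hb
      rw [List.mem_cons] at this
      exact this.elim (fun h => hw.1 h.symm) haw

end Creeping

end OperatorGrowth

/-! ### The Hilbert–Schmidt geometry of operators -/

namespace OperatorGrowth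

section HilbertSchmidt

open scoped InnerProductSpace

variable {V : Type*} [Fintype V] [DecidableEq V] {d : V → ℕ}

/-- Operators as vectors of matrix entries: the space of operators with the Hilbert–Schmidt norm. -/
abbrev HS (d : V → ℕ) : Type _ := EuclideanSpace ℂ (Config d × Config d)

/-- An operator as a vector of the Hilbert–Schmidt space. -/
noncomputable def hsVec : Op d ≃ₗ[ℝ] HS d where
  toFun A := WithLp.toLp 2 fun p => A p.1 p.2
  invFun e := Matrix.of fun x y => e (x, y)
  map_add' _ _ := rfl
  map_smul' _ _ := rfl
  left_inv _ := rfl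
  right_inv _ := rfl

omit [Fintype V] [DecidableEq V] in
theorem hsVec_apply (A : Op d) (p : Config d × Config d) : hsVec A p = A p.1 p.2 := rfl

theorem inner_hsVec (A B : Op d) : ⟪hsVec A, hsVec B⟫_ℝ = (A.conjTranspose * B).trace.re := by
  rw [PiLp.inner_apply, Fintype.sum_prod_type, Finset.sum_comm, Matrix.trace, Complex.re_sum]
  refine Finset.sum_congr rfl fun y _ => ?_
  rw [Matrix.diag_apply, Matrix.mul_apply, Complex.re_sum]
  refine Finset.sum_congr rfl fun x _ => ?_
  rw [Complex.inner, Matrix.conjTranspose_apply, hsVec_apply, hsVec_apply, mul_comm]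
  rfl

theorem norm_hsVec_conjTranspose (A : Op d) : ‖hsVec A.conjTranspose‖ = ‖hsVec A‖ := by
  rw [← sq_eq_sq₀ (norm_nonneg _) (norm_nonneg _), ← real_inner_self_eq_norm_sq,
    ← real_inner_self_eq_norm_sq, inner_hsVec, inner_hsVec, Matrix.conjTranspose_conjTranspose,
    Matrix.trace_mul_comm]

theorem abs_re_trace_mul_le (A B : Op d) : |(A * B).trace.re| ≤ ‖hsVec A‖ * ‖hsVec B‖ := by
  have h := abs_real_inner_le_norm (hsVec A.conjTranspose) (hsVec B)
  rwa [inner_hsVec, Matrix.conjTranspose_conjTranspose, norm_hsVec_conjTranspose] at h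

theorem norm_hsVec_mul_le (H A : Op d) : ‖hsVec (H * A)‖ ≤ ‖H‖ * ‖hsVec A‖ := by
  have hsq : ∀ B : Op d, ‖hsVec B‖ ^ 2 =
      ∑ y, ‖(WithLp.toLp 2 (B.col y) : EuclideanSpace ℂ (Config d))‖ ^ 2 := by
    intro B
    rw [EuclideanSpace.norm_sq_eq, Fintype.sum_prod_type, Finset.sum_comm]
    refine Finset.sum_congr rfl fun y _ => ?_
    rw [EuclideanSpace.norm_sq_eq]
    rfl
  rw [← sq_le_sq₀ (norm_nonneg _) (by positivity), mul_pow, hsq, hsq, Finset.mul_sum]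
  refine Finset.sum_le_sum fun y _ => ?_
  rw [← mul_pow]
  exact pow_le_pow_left₀ (norm_nonneg _)
    (Matrix.l2_opNorm_mulVec H (WithLp.toLp 2 (A.col y))) 2

theorem norm_hsVec_mul_le' (A H : Op d) : ‖hsVec (A * H)‖ ≤ ‖H‖ * ‖hsVec A‖ := by
  rw [← norm_hsVec_conjTranspose, Matrix.conjTranspose_mul, ← Matrix.l2_opNorm_conjTranspose H,
    ← norm_hsVec_conjTranspose A]
  exact norm_hsVec_mul_le _ _

theorem norm_hsVec_smul (c : ℂ) (A : Op d) : ‖hsVec (c • A)‖ = ‖c‖ * ‖hsVec A‖ :=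
  norm_smul c (hsVec A)

theorem norm_hsVec_liouvillian_le (H A : Op d) :
    ‖hsVec (liouvillian H A)‖ ≤ 2 * ‖H‖ * ‖hsVec A‖ := by
  rw [liouvillian_apply, norm_hsVec_smul, Complex.norm_I, one_mul, map_sub]
  refine (norm_sub_le_of_le (norm_hsVec_mul_le H A) (norm_hsVec_mul_le' A H)).trans_eq ?_
  ring

theorem trace_liouvillian_mul (H A B : Op d) :
    (liouvillian H A * B).trace = -(A * liouvillian H B).trace := by
  rw [liouvillian_apply, liouvillian_apply, smul_mul_assoc, mul_smul_comm, Matrix.trace_smul,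
    Matrix.trace_smul, sub_mul, mul_sub, Matrix.trace_sub, Matrix.trace_sub, mul_assoc H A B,
    Matrix.trace_mul_comm H, mul_assoc, mul_assoc, ← smul_neg, neg_sub]

theorem conjTranspose_liouvillian {H : Op d} (hH : H.IsHermitian) (A : Op d) :
    (liouvillian H A).conjTranspose = liouvillian H A.conjTranspose := by
  rw [liouvillian_apply, liouvillian_apply, Matrix.conjTranspose_smul, Matrix.conjTranspose_sub,
    Matrix.conjTranspose_mul, Matrix.conjTranspose_mul, hH.eq, Complex.star_def, Complex.conj_I,
    neg_smul, ← smul_neg, neg_sub]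

/-- The Liouvillian of a Hermitian operator is skew. -/
theorem inner_hsVec_liouvillian {H : Op d} (hH : H.IsHermitian) (A : Op d) :
    ⟪hsVec (liouvillian H A), hsVec A⟫_ℝ = 0 := by
  have h1 : ⟪hsVec (liouvillian H A), hsVec A⟫_ℝ = -⟪hsVec A, hsVec (liouvillian H A)⟫_ℝ := by
    rw [inner_hsVec, inner_hsVec, conjTranspose_liouvillian hH, trace_liouvillian_mul,
      Complex.neg_re]
  have h2 := real_inner_comm (hsVec A) (hsVec (liouvillian H A))
  linarith

omit [Fintype V] in
theorem conjTranspose_trivialPart (j : V) (A : Op d) :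
    (trivialPart j A).conjTranspose = trivialPart j A.conjTranspose := by
  ext x y
  by_cases h : x j = y j
  · simp [trivialPart, h]
  · simp [trivialPart, h, Ne.symm h]

omit [Fintype V] in
theorem conjTranspose_proj (j : V) (A : Op d) :
    (proj j A).conjTranspose = proj j A.conjTranspose := by
  simp only [proj, LinearMap.sub_apply, LinearMap.id_apply, Matrix.conjTranspose_sub,
    conjTranspose_trivialPart]

/-- Taking the trivial part is symmetric for the trace form: exchanging the label of the factor at
`j` with the summation variable of the partial trace exchanges the two sides. -/
theorem trace_trivialPart_mul (j : V) (A B : Op d) :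
    (trivialPart j A * B).trace = (A * trivialPart j B).trace := by
  have h1 : (trivialPart j A * B).trace = (d j : ℂ)⁻¹ * ∑ p : Config d × Config d × Fin (d j),
      if p.1 j = p.2.1 j then
        A (Function.update p.1 j p.2.2) (Function.update p.2.1 j p.2.2) * B p.2.1 p.1 else 0 := by
    simp only [Matrix.trace, Matrix.diag_apply, Matrix.mul_apply, Fintype.sum_prod_type,
      Finset.mul_sum]
    refine Finset.sum_congr rfl fun x _ => Finset.sum_congr rfl fun y _ => ?_
    by_cases h : x j = y j
    · simp [trivialPart, h, Finset.mul_sum, Finset.sum_mul, mul_assoc]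
    · simp [trivialPart, h]
  have h2 : (A * trivialPart j B).trace = (d j : ℂ)⁻¹ * ∑ p : Config d × Config d × Fin (d j),
      if p.1 j = p.2.1 j then
        A p.1 p.2.1 * B (Function.update p.2.1 j p.2.2) (Function.update p.1 j p.2.2) else 0 := by
    simp only [Matrix.trace, Matrix.diag_apply, Matrix.mul_apply, Fintype.sum_prod_type,
      Finset.mul_sum]
    refine Finset.sum_congr rfl fun x _ => Finset.sum_congr rfl fun y _ => ?_
    by_cases h : x j = y j
    · simp [trivialPart, h, Finset.mul_sum, mul_left_comm]
    · simp [trivialPart, h, Ne.symm h]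
  rw [h1, h2, ← Finset.sum_filter, ← Finset.sum_filter]
  congr 1
  let e : Config d × Config d × Fin (d j) → Config d × Config d × Fin (d j) := fun p =>
    (Function.update p.1 j p.2.2, Function.update p.2.1 j p.2.2, p.1 j)
  have he : ∀ p ∈ ({p | p.1 j = p.2.1 j} : Finset (Config d × Config d × Fin (d j))),
      e p ∈ ({p | p.1 j = p.2.1 j} : Finset (Config d × Config d × Fin (d j))) := fun p _ => by
    simp [e]
  have hee : ∀ p ∈ ({p | p.1 j = p.2.1 j} : Finset (Config d × Config d × Fin (d j))),
      e (e p) = p := by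
    rintro ⟨x, y, s⟩ hp
    have hp' : x j = y j := by simpa using hp
    simp only [e, Function.update_idem, Function.update_self, Function.update_eq_self]
    rw [hp', Function.update_eq_self]
  refine Finset.sum_nbij' e e he he hee hee fun p hp => ?_
  have hp' : p.1 j = p.2.1 j := by simpa using hp
  simp only [e, Function.update_idem, Function.update_eq_self]
  rw [hp', Function.update_eq_self]

theorem trace_proj_mul (j : V) (A B : Op d) : (proj j A * B).trace = (A * proj j B).trace := by
  simp only [proj, LinearMap.sub_apply, LinearMap.id_apply, sub_mul, mul_sub, Matrix.trace_sub,
    trace_trivialPart_mul]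

theorem inner_hsVec_proj (j : V) (A B : Op d) :
    ⟪hsVec (proj j A), hsVec B⟫_ℝ = ⟪hsVec A, hsVec (proj j B)⟫_ℝ := by
  rw [inner_hsVec, inner_hsVec, conjTranspose_proj, trace_proj_mul]

omit [Fintype V] in
theorem proj_proj (hd : ∀ v, 1 < d v) (j : V) (A : Op d) : proj j (proj j A) = proj j A := by
  have h := (trivialPart_eq_self_iff hd).2 (actsTrivially_trivialPart j A)
  simp only [proj, LinearMap.sub_apply, LinearMap.id_apply, map_sub, h, sub_self, sub_zero]

theorem inner_hsVec_proj_self (hd : ∀ v, 1 < d v) (j : V) (A : Op d) :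
    ⟪hsVec A, hsVec (proj j A)⟫_ℝ = ‖hsVec (proj j A)‖ ^ 2 := by
  rw [← real_inner_self_eq_norm_sq, inner_hsVec_proj, proj_proj hd]

theorem norm_hsVec_proj_le (hd : ∀ v, 1 < d v) (j : V) (A : Op d) :
    ‖hsVec (proj j A)‖ ≤ ‖hsVec A‖ := by
  have h := real_inner_le_norm (hsVec A) (hsVec (proj j A))
  rw [inner_hsVec_proj_self hd, sq] at h
  obtain h0 | h0 := (norm_nonneg (hsVec (proj j A))).eq_or_lt
  · rw [← h0]
    exact norm_nonneg _
  · exact le_of_mul_le_mul_right h h0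

/-- The Liouvillian on the Hilbert–Schmidt space. -/
noncomputable def hsLiouvillian (H : Op d) : HS d →L[ℝ] HS d :=
  LinearMap.toContinuousLinearMap
    (hsVec.toLinearMap ∘ₗ (liouvillian H).restrictScalars ℝ ∘ₗ hsVec.symm.toLinearMap)

theorem hsLiouvillian_hsVec (H A : Op d) :
    hsLiouvillian H (hsVec A) = hsVec (liouvillian H A) := rfl

theorem norm_hsLiouvillian_le (H : Op d) : ‖hsLiouvillian H‖ ≤ 2 * ‖H‖ := by
  refine ContinuousLinearMap.opNorm_le_bound _ (by positivity) fun e => ?_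
  obtain ⟨A, rfl⟩ := hsVec.surjective e
  exact norm_hsVec_liouvillian_le H A

theorem inner_hsLiouvillian {H : Op d} (hH : H.IsHermitian) (e : HS d) :
    ⟪hsLiouvillian H e, e⟫_ℝ = 0 := by
  obtain ⟨A, rfl⟩ := hsVec.surjective e
  exact inner_hsVec_liouvillian hH A

/-- The bilinear form `Re tr (A (ℙ_j B))`. -/
noncomputable def projForm (hd : ∀ v, 1 < d v) (j : V) : HS d →L[ℝ] HS d →L[ℝ] ℝ :=
  LinearMap.mkContinuous₂
    (LinearMap.mk₂ ℝ (fun e e' => (hsVec.symm e * proj j (hsVec.symm e')).trace.re)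
      (fun _ _ _ => by simp [add_mul])
      (fun c e _ => by
        simp only [map_smul, smul_mul_assoc, Matrix.trace_smul, Complex.smul_re])
      (fun _ _ _ => by simp [mul_add])
      (fun c e e' => by
        have : proj j (c • hsVec.symm e') = c • proj j (hsVec.symm e') :=
          ((proj j).restrictScalars ℝ).map_smul c _
        simp only [map_smul, this, mul_smul_comm, Matrix.trace_smul, Complex.smul_re])) 1
    fun e e' => by
      obtain ⟨A, rfl⟩ := hsVec.surjective e
      obtain ⟨B, rfl⟩ := hsVec.surjective e'
      rw [one_mul]
      refine (abs_re_trace_mul_le A (proj j B)).trans ?_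
      gcongr
      exact norm_hsVec_proj_le hd j B

theorem projForm_hsVec (hd : ∀ v, 1 < d v) (j : V) (A B : Op d) :
    projForm hd j (hsVec A) (hsVec B) = (A * proj j B).trace.re := rfl

theorem abs_projForm_le (hd : ∀ v, 1 < d v) (j : V) (e e' : HS d) :
    |projForm hd j e e'| ≤ ‖e‖ * ‖e'‖ := by
  obtain ⟨A, rfl⟩ := hsVec.surjective e
  obtain ⟨B, rfl⟩ := hsVec.surjective e'
  refine (abs_re_trace_mul_le A (proj j B)).trans ?_
  gcongr
  exact norm_hsVec_proj_le hd j B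

end HilbertSchmidt

end OperatorGrowth

/-! ### Time evolution and the averaged bound -/

namespace OperatorGrowth

section Evolution

open scoped InnerProductSpace

variable {V F : Type*} [Fintype V] [DecidableEq V] {d : V → ℕ} {H : F → Op d} {A : Op d}

theorem applyWord_hsVec (J : F → ℝ) (j : V) (w : List F) :
    applyWord (fun X => hsLiouvillian (H X)) J (hsVec A) w =
      (w.map J).prod • hsVec (vertexWord H j A (w.map .factor)) := by
  induction w with
  | nil => simp [applyWord, vertexWord]
  | cons x w ih =>
    have h : applyWord (fun X => hsLiouvillian (H X)) J (hsVec A) (x :: w) =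
      J x • hsLiouvillian (H x) (applyWord (fun X => hsLiouvillian (H X)) J (hsVec A) w) := rfl
    rw [h, ih, map_smul, smul_smul]
    rfl

/-- Moving the Liouvillians from one side of the trace to the other, by skewness. -/
theorem trace_vertexWord_mul (j : V) (u : List F) (w : List (CausalVertex F))
    (h : (vertexWord H j A (u.map .factor) * vertexWord H j A w).trace.re ≠ 0) :
    vertexWord H j A (u.reverse.map .factor ++ w) ≠ 0 := by
  induction u generalizing w with
  | nil =>
    intro h0
    apply h
    simp only [List.reverse_nil, List.map_nil, List.nil_append] at h0
    simp [h0]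
  | cons x u ih =>
    rw [List.reverse_cons, List.map_append, List.append_assoc]
    refine ih (.factor x :: w) fun h0 => h ?_
    have h1 := trace_liouvillian_mul (H x) (vertexWord H j A (u.map .factor)) (vertexWord H j A w)
    rw [List.map_cons, vertexWord_cons]
    exact (congrArg Complex.re h1).trans (by rw [Complex.neg_re]; exact neg_eq_zero.2 h0)

theorem creeps_of_projForm_ne_zero [DecidableEq F] (hd : ∀ v, 1 < d v) {supp : F → Finset V}
    (hH : ∀ X, SupportedOn (supp X) (H X)) {i j : V} (hA : SupportedOn {i} A) {J : F → ℝ}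
    {u v : List F}
    (h : projForm hd j (applyWord (fun X => hsLiouvillian (H X)) J (hsVec A) u)
      (applyWord (fun X => hsLiouvillian (H X)) J (hsVec A) v) ≠ 0) :
    Creeps (touches supp i j) (outwardWord u v) ∧ Creeps (touches supp i j) (outwardWord v u) := by
  have hrev : ∀ u v : List F, (outwardWord u v).reverse = outwardWord v u := fun u v => by
    simp [outwardWord]
  have hroot : ∀ u v : List F, CausalVertex.root ∉ outwardWord u v := fun u v => by
    simp [mem_outwardWord]
  rw [applyWord_hsVec J j, applyWord_hsVec J j, map_smul, map_smul, smul_apply,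
    projForm_hsVec] at h
  have h1 : (vertexWord H j A (u.map .factor) *
      vertexWord H j A (.target :: v.map .factor)).trace.re ≠ 0 := fun h0 => h (by
    rw [show proj j (vertexWord H j A (v.map .factor)) =
      vertexWord H j A (.target :: v.map .factor) from rfl, h0, smul_zero, smul_zero])
  have h2 : (vertexWord H j A (v.map .factor) *
      vertexWord H j A (.target :: u.map .factor)).trace.re ≠ 0 := by
    rwa [vertexWord_cons, vertexMap, ← trace_proj_mul, Matrix.trace_mul_comm]
  constructor
  · rw [← hrev]
    exact creeps_reverse_of_vertexWord_ne_zero hd hH hA (hroot _ _) (trace_vertexWord_mul j v _ h2)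
  · rw [← hrev]
    exact creeps_reverse_of_vertexWord_ne_zero hd hH hA (hroot _ _) (trace_vertexWord_mul j u _ h1)

theorem hasSum_evolve (H A : Op d) (t : ℝ) :
    HasSum (fun n => (t ^ n / (n ! : ℝ) : ℝ) • ((liouvillian H) ^ n) A) (evolve H t A) := by
  have h := NormedSpace.exp_series_hasSum_exp' (𝕂 := ℂ)
    ((t : ℂ) • LinearMap.toContinuousLinearMap (liouvillian H))
  have h2 := (ContinuousLinearMap.apply ℂ (Op d) A).hasSum h
  refine h2.congr_fun fun n => ?_
  have hpow : ∀ n, (((t : ℂ) • LinearMap.toContinuousLinearMap (liouvillian H)) ^ n) A =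
      (t : ℂ) ^ n • ((liouvillian H) ^ n) A := fun n => by
    induction n with
    | zero => simp
    | succ n ih =>
      rw [pow_succ', mul_apply_eq_comp, ih, pow_succ' (liouvillian H), Module.End.mul_apply,
        smul_apply, map_smul, smul_smul, pow_succ' (t : ℂ)]
      rfl
  rw [ContinuousLinearMap.apply_apply, smul_apply, hpow, smul_smul, ← Complex.coe_smul]
  congr 1
  push_cast
  ring

theorem hasSum_hsVec_evolve [Fintype F] (H : F → Op d) (J : F → ℝ) (A : Op d) (t : ℝ) :
    HasSum (fun n => (t ^ n / (n ! : ℝ)) • ((∑ X, J X • hsLiouvillian (H X)) ^ n) (hsVec A))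
      (hsVec (evolve (hamiltonian H J) t A)) := by
  have hlin : ∀ B, (∑ X, J X • hsLiouvillian (H X)) (hsVec B) =
      hsVec (liouvillian (hamiltonian H J) B) := fun B => by
    rw [sum_apply, liouvillian_apply, hamiltonian, Finset.sum_mul, Finset.mul_sum,
      ← Finset.sum_sub_distrib, Finset.smul_sum, map_sum]
    refine Finset.sum_congr rfl fun X _ => ?_
    rw [smul_apply, hsLiouvillian_hsVec, ← map_smul, liouvillian_apply, smul_mul_assoc,
      mul_smul_comm, ← smul_sub, smul_comm Complex.I, Complex.coe_smul]
  have hpow : ∀ n, ((∑ X, J X • hsLiouvillian (H X)) ^ n) (hsVec A) =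
      hsVec (((liouvillian (hamiltonian H J)) ^ n) A) := fun n => by
    induction n with
    | zero => rfl
    | succ n ih =>
      rw [pow_succ', mul_apply_eq_comp, ih, hlin, pow_succ']
      rfl
  have h := (LinearMap.toContinuousLinearMap (hsVec (d := d)).toLinearMap).hasSum
    (hasSum_evolve (hamiltonian H J) A t)
  refine h.congr_fun fun n => ?_
  rw [hpow]
  exact ((hsVec (d := d)).map_smul _ _).symm

omit [Fintype V] [DecidableEq V] in
theorem isHermitian_hamiltonian [Fintype F] (hH : ∀ X, (H X).IsHermitian) (J : F → ℝ) :
    (hamiltonian H J).IsHermitian := by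
  rw [Matrix.IsHermitian, hamiltonian, Matrix.conjTranspose_sum]
  refine Finset.sum_congr rfl fun X _ => ?_
  rw [Matrix.conjTranspose_smul, (hH X).eq, Complex.star_def, Complex.conj_ofReal]

theorem isHermitian_evolve {H A : Op d} (hH : H.IsHermitian) (hA : A.IsHermitian) (t : ℝ) :
    (evolve H t A).IsHermitian := by
  have hpow : ∀ n, (((liouvillian H) ^ n) A).conjTranspose = ((liouvillian H) ^ n) A := fun n => by
    induction n with
    | zero => exact hA
    | succ n ih =>
      rw [pow_succ', Module.End.mul_apply, conjTranspose_liouvillian hH, ih]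
  have h := hasSum_evolve H A t
  have h' := h.matrix_conjTranspose
  refine h'.unique (h.congr_fun fun n => ?_)
  rw [Matrix.conjTranspose_smul, hpow, star_trivial]

/-- For Hermitian operators the squared growth is the form `Re tr (A(t) (ℙ_j A(t)))`, divided by the
squared Hilbert–Schmidt norm of `A`. -/
theorem growth_sq (hd : ∀ v, 1 < d v) {H A : Op d} (hH : H.IsHermitian) (hA : A.IsHermitian)
    (j : V) (t : ℝ) :
    growth H A j t ^ 2 =
      projForm hd j (hsVec (evolve H t A)) (hsVec (evolve H t A)) / ‖hsVec A‖ ^ 2 := by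
  have hcard : (Fintype.card (Config d) : ℝ) ≠ 0 := by
    have : Nonempty (Config d) := ⟨fun v => ⟨0, by have := hd v; omega⟩⟩
    exact_mod_cast Fintype.card_ne_zero
  have hAA : (A * A).trace.re = ‖hsVec A‖ ^ 2 := by
    rw [← real_inner_self_eq_norm_sq, inner_hsVec, hA.eq]
  have hE : projForm hd j (hsVec (evolve H t A)) (hsVec (evolve H t A)) =
      ‖hsVec (proj j (evolve H t A))‖ ^ 2 := by
    rw [projForm_hsVec, ← inner_hsVec_proj_self hd, inner_hsVec, (isHermitian_evolve hH hA t).eq]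
  have hq : hsInner (evolve H t A) (proj j (evolve H t A)) / hsInner A A =
      projForm hd j (hsVec (evolve H t A)) (hsVec (evolve H t A)) / ‖hsVec A‖ ^ 2 := by
    rw [hsInner, hsInner, hAA, projForm_hsVec, div_div_div_cancel_right₀ hcard]
  rw [growth, Real.sq_sqrt, hq]
  rw [hq, hE]
  positivity

end Evolution

end OperatorGrowth

theorem mainTheorem2 {V F : Type*} [Fintype V] [DecidableEq V] [Fintype F] [DecidableEq F]
    (d : V → ℕ) (hd : ∀ v, 1 < d v)
    (supp : F → Finset V)
    (H : F → OperatorGrowth.Op d)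
    (hHerm : ∀ X, (H X).IsHermitian)
    (hHloc : ∀ X, OperatorGrowth.IsLocal (supp X) (H X))
    (hHorth : ∀ X Y, OperatorGrowth.hsInner (H X) (H Y) = if X = Y then 1 else 0)
    (μ : F → Measure ℝ) [∀ X, IsProbabilityMeasure (μ X)]
    (hL2 : ∀ X, MemLp (fun x : ℝ => x) 2 (μ X))
    (hmean : ∀ X, ∫ x, x ∂(μ X) = 0)
    (𝒥 : F → ℝ) (hvar : ∀ X, ∫ x, x ^ 2 ∂(μ X) = 𝒥 X ^ 2)
    (i j : V) (hij : i ≠ j)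
    (A : OperatorGrowth.Op d) (hAherm : A.IsHermitian)
    (hAloc : OperatorGrowth.IsLocal {i} A) (hA : A ≠ 0)
    (t : ℝ) :
    Integrable (fun J : F → ℝ =>
        OperatorGrowth.growth (OperatorGrowth.hamiltonian H J) A j t ^ 2) (Measure.pi μ) ∧
    ∫ J : F → ℝ, OperatorGrowth.growth (OperatorGrowth.hamiltonian H J) A j t ^ 2
        ∂(Measure.pi μ) ≤
      OperatorGrowth.treePairSum supp i j (fun X => 𝒥 X * ‖H X‖) t ∧
    ((∀ X, ‖H X‖ = 1) →
      ∫ J : F → ℝ, OperatorGrowth.growth (OperatorGrowth.hamiltonian H J) A j t ^ 2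
          ∂(Measure.pi μ) ≤
        OperatorGrowth.treePairSum supp i j 𝒥 t) := by
  have hsupp := fun X => (hHloc X).supportedOn hd
  have hpos : 0 < ‖OperatorGrowth.hsVec A‖ ^ 2 := by
    have : OperatorGrowth.hsVec A ≠ 0 := fun h => hA (by simpa using h)
    positivity
  obtain ⟨hint, hle⟩ := OperatorGrowth.integral_bilin_evolved_le (supp := supp) (t := t) hij hL2
    hmean hvar (fun X => OperatorGrowth.inner_hsLiouvillian (hHerm X))
    (fun X => OperatorGrowth.norm_hsLiouvillian_le (H X)) (OperatorGrowth.abs_projForm_le hd j)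
    (fun J u v => OperatorGrowth.creeps_of_projForm_ne_zero hd hsupp (hAloc.supportedOn hd))
    (fun J => OperatorGrowth.hasSum_hsVec_evolve H J A t)
  have hgrowth : ∀ J : F → ℝ, OperatorGrowth.growth (OperatorGrowth.hamiltonian H J) A j t ^ 2 =
      OperatorGrowth.projForm hd j
        (OperatorGrowth.hsVec (OperatorGrowth.evolve (OperatorGrowth.hamiltonian H J) t A))
        (OperatorGrowth.hsVec (OperatorGrowth.evolve (OperatorGrowth.hamiltonian H J) t A)) /
        ‖OperatorGrowth.hsVec A‖ ^ 2 := fun J =>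
    OperatorGrowth.growth_sq hd (OperatorGrowth.isHermitian_hamiltonian hHerm J) hAherm j t
  have hbound : ∫ J : F → ℝ, OperatorGrowth.growth (OperatorGrowth.hamiltonian H J) A j t ^ 2
      ∂(Measure.pi μ) ≤ OperatorGrowth.treePairSum supp i j (fun X => 𝒥 X * ‖H X‖) t := by
    simp only [hgrowth]
    rw [integral_div, div_le_iff₀ hpos, mul_comm]
    exact hle
  refine ⟨?_, hbound, fun hone => ?_⟩
  · simp only [hgrowth]
    exact hint.div_const _
  · simpa only [hone, mul_one] using hbound
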